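/- Let $X$ and $Y$ be finite partially ordered sets and let $(Y_x)_{x\in X}$ be a family of subsets of $Y$. For $y\in Y$ write $[y,\cdot]=\{y'\in Y: y'\ge y\}$ and $[\cdot,y]=\{y'\in Y: y'\le y\}$. Assume that $[y,\cdot]\cap[y',\cdot]=\emptyset$ and $[\cdot,y]\cap[\cdot,y']=\emptyset$ for all $x\in X$ and all $y\ne y'$ in $Y_x$, and that for all $x\le x'$ in $X$ there is a bijection $\varphi_{x,x'}:Y_x\to Y_{x'}$ with $y\le\varphi_{x,x'}(y)$ for all $y\in Y_x$. Define two partial orders $\le_+$ and $\le_-$ on the disjoint union $X\sqcup Y$ as follows. Both restrict to the given orders on $X$ and on $Y$; for $x\in X$ and $y\in Y$, $$x\le_+ y \iff \exists\, y_x\in Y_x:\ y_x\le y,\qquad\qquad y\le_- x\iff \exists\, y_x\in Y_x:\ y\le y_x;$$ and there are no other relations. Then the posets $(X\sqcup Y,\le_+)$ and $(X\sqcup Y,\le_-)$ are universally derived equivalent. That is, for every abelian category $\mathcal A$ the unbounded derived categories $D(\mathcal A^{\le_+})$ and $D(\mathcal A^{\le_-})$ are equivalent as triangulated categories, where for a poset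 $P$ (viewed as a category with a unique morphism $p\to p'$ whenever $p\le p'$) $\mathcal A^{P}$ denotes the category of functors $P\to\mathcal A$. -/

import Mathlib

open CategoryTheory

universe u v w w' p q

section Triangulated

open Limits Pretriangulated

/-- Two (pre)triangulated categories are equivalent as triangulated categories: there is an
equivalence of categories between them, whose functors in both directions commute with the shifts
(compatibly with the unit and the counit) and send distinguished triangles to distinguished
triangles. -/
def TriangulatedEquivalent (C : Type*) (D : Type*) [Category C] [Category D]
    [HasZeroObject C] [HasZeroObject D] [Preadditive C] [Preadditive D]
    [HasShift C ℤ] [HasShift D ℤ]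
    [∀ n : ℤ, (shiftFunctor C n).Additive] [∀ n : ℤ, (shiftFunctor D n).Additive]
    [Pretriangulated C] [Pretriangulated D] : Prop :=
  ∃ (e : C ≌ D) (_ : e.functor.CommShift ℤ) (_ : e.inverse.CommShift ℤ),
    e.IsTriangulated

end Triangulated

/-- Two posets `P` and `Q` are universally derived equivalent if for every abelian category `A`,
the (unbounded) derived categories of the categories of diagrams `P ⥤ A` and `Q ⥤ A` are equivalent
as triangulated categories. The instance arguments `HasDerivedCategory` only choose models of
these two derived categories, i.e. localizations of the categories of cochain complexes at the
quasi-isomorphisms; the equivalence is required for all choices of models. -/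
def UniversallyDerivedEquivalent (P : Type p) (Q : Type q) [PartialOrder P] [PartialOrder Q] :
    Prop :=
  ∀ (A : Type u) [Category.{v} A] [Abelian A]
    [HasDerivedCategory.{w} (P ⥤ A)] [HasDerivedCategory.{w'} (Q ⥤ A)],
    TriangulatedEquivalent (DerivedCategory (P ⥤ A)) (DerivedCategory (Q ⥤ A))

section Gluing

variable {X : Type p} {Y : Type q} [PartialOrder X] [PartialOrder Y]

/-- For all `x ≤ x'` there is a bijection `φ : S x ≃ S x'` such that `y ≤ φ y` for all `y`. -/
def HasIncreasingBijections (S : X → Set Y) : Prop :=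
  ∀ x x' : X, x ≤ x' → ∃ φ : S x ≃ S x', ∀ y : S x, (y : Y) ≤ (φ y : Y)

/-- The relation `≤₊` on `X ⊔ Y`. -/
def PlusLE (S : X → Set Y) : X ⊕ Y → X ⊕ Y → Prop
  | Sum.inl x, Sum.inl x' => x ≤ x'
  | Sum.inr y, Sum.inr y' => y ≤ y'
  | Sum.inl x, Sum.inr y => ∃ z ∈ S x, z ≤ y
  | Sum.inr _, Sum.inl _ => False

/-- The relation `≤₋` on `X ⊔ Y`. -/
def MinusLE (S : X → Set Y) : X ⊕ Y → X ⊕ Y → Prop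
  | Sum.inl x, Sum.inl x' => x ≤ x'
  | Sum.inr y, Sum.inr y' => y ≤ y'
  | Sum.inr y, Sum.inl x => ∃ z ∈ S x, y ≤ z
  | Sum.inl _, Sum.inr _ => False

/-- The disjoint union `X ⊔ Y`, to be equipped with the order `≤₊`. -/
def PlusPoset (S : X → Set Y) (_ : HasIncreasingBijections S) : Type (max p q) := X ⊕ Y

/-- The disjoint union `X ⊔ Y`, to be equipped with the order `≤₋`. -/
def MinusPoset (S : X → Set Y) (_ : HasIncreasingBijections S) : Type (max p q) := X ⊕ Y

instance PlusPoset.instPartialOrder (S : X → Set Y) (h : HasIncreasingBijections S) :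
    PartialOrder (PlusPoset S h) where
  le := PlusLE S
  le_refl := by
    rintro (x | y)
    · exact le_refl x
    · exact le_refl y
  le_trans := by
    rintro (a | a) (b | b) (c | c) hab hbc
    · exact le_trans (α := X) hab hbc
    · obtain ⟨z, hz, hzc⟩ := hbc
      obtain ⟨φ, hφ⟩ := h a b hab
      refine ⟨φ.symm ⟨z, hz⟩, (φ.symm ⟨z, hz⟩).2, le_trans ?_ hzc⟩
      simpa using hφ (φ.symm ⟨z, hz⟩)
    · exact hbc.elim
    · obtain ⟨z, hz, hzb⟩ := hab
      exact ⟨z, hz, le_trans hzb hbc⟩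
    · exact hab.elim
    · exact hab.elim
    · exact hbc.elim
    · exact le_trans (α := Y) hab hbc
  le_antisymm := by
    rintro (a | a) (b | b) hab hba
    · exact congrArg Sum.inl (le_antisymm (α := X) hab hba)
    · exact hba.elim
    · exact hab.elim
    · exact congrArg Sum.inr (le_antisymm (α := Y) hab hba)

instance MinusPoset.instPartialOrder (S : X → Set Y) (h : HasIncreasingBijections S) :
    PartialOrder (MinusPoset S h) where
  le := MinusLE S
  le_refl := by
    rintro (x | y)
    · exact le_refl x
    · exact le_refl y
  le_trans := by
    rintro (a | a) (b | b) (c | c) hab hbc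
    · exact le_trans (α := X) hab hbc
    · exact hbc.elim
    · exact hab.elim
    · exact hab.elim
    · obtain ⟨z, hz, haz⟩ := hab
      obtain ⟨φ, hφ⟩ := h b c hbc
      exact ⟨φ ⟨z, hz⟩, (φ ⟨z, hz⟩).2, le_trans haz (hφ ⟨z, hz⟩)⟩
    · exact hbc.elim
    · obtain ⟨z, hz, hbz⟩ := hbc
      exact ⟨z, hz, le_trans hab hbz⟩
    · exact le_trans (α := Y) hab hbc
  le_antisymm := by
    rintro (a | a) (b | b) hab hba
    · exact congrArg Sum.inl (le_antisymm (α := X) hab hba)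
    · exact hab.elim
    · exact hba.elim
    · exact congrArg Sum.inr (le_antisymm (α := Y) hab hba)

end Gluing

/-! A diagram `K` on `≤₊` has, for every `x`, a map `K x ⟶ ⨁ K z` over `z ∈ S x`, and a diagram `L`
on `≤₋` has a map `⨁ L z ⟶ L x`. The equivalence is of reflection type: it keeps `K` on `Y` and
replaces `K x` by the cone of the first map; the way back uses the cone of the second, with a shift
on `Y`.

The combinatorial hypotheses make `x ↦ ⨁ N z` functorial for `N : Y ⥤ A`. For `x ≤ x'` the matrix
with entries the maps `N z ⟶ N z'`, `z ≤ z'`, has exactly one such entry in each row and column. The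
disjointness conditions also make the gluing maps `⨁ N z ⟶ N y` and `N y ⟶ ⨁ N z` independent of the
element of `S x` through which they are written.

Globally there are exact functors `U`, `V` from diagrams on `≤₊` to diagrams on `≤₋`: `U` restricts
to `X` and extends by zero, `V` restricts to `Y` and extends by biproducts. In the other direction,
`U'`, `V'` are defined likewise. With `α : U ⟶ V` and `β : V' ⟶ U'` given by the maps above, set `F
= cone α` and `G = cone β` on complexes. Since the four functors are exact, `F` and `G` preserve
quasi-isomorphisms and descend to unbounded derived categories with no resolutions.

The composite `G F K` is the total complex with pieces `V'U K`, `V'V K ⊕ U'U K`, `U'V K`. Here `V'U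
= 0`, and `K` is the corner of a square `K ⟶ V'V K, U'U K ⟶ U'V K` whose associated short complex is
exact, because at each point two opposite sides are isomorphisms. Hence `K⟦1⟧ ⟶ G F K` is a
quasi-isomorphism. Dually `V U' = 0`, and the square `U V' L ⟶ U U' L, V V' L ⟶ L` gives `F G L ⟶
L⟦1⟧`. As the shift is an equivalence, so is the functor induced by `F`; it is triangulated because
`F` commutes with shifts and mapping cones up to explicit signs.

The formal half is `triangulatedEquivalent_of_coneFunctor`; the poset half consists of
`shortExact_commSq_toMinusX`, `shortExact_commSq_toPlusX` and the vanishing lemmas. -/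

open Limits Category Preadditive Pretriangulated

/-! ### Sign and index conventions for shifts and mapping cones -/

namespace CochainComplex

section Shift

variable {C : Type*} [Category C] [Preadditive C]

/-- The term in degree `i` of the shifted complex `K⟦a⟧` is the term of `K` in degree `i + a`. -/
def shiftXIso (K : CochainComplex C ℤ) (a i m : ℤ) (h : i + a = m) : (K⟦a⟧).X i ≅ K.X m :=
  K.XIsoOfEq h

/-- The sign `(-1)^a` of the shifted differential. Free indices together with `shiftXIso` keep later
computations away from terms that agree only up to arithmetic in `ℤ`. -/
lemma shift_d_comp_shiftXIso_hom (K : CochainComplex C ℤ) (a i j m n : ℤ)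
    (hi : i + a = m) (hj : j + a = n) :
    (K⟦a⟧).d i j ≫ (K.shiftXIso a j n hj).hom =
      a.negOnePow • (K.shiftXIso a i m hi).hom ≫ K.d m n := by
  subst hi hj
  simp only [shiftXIso, HomologicalComplex.XIsoOfEq_rfl, Iso.refl_hom]
  erw [comp_id, id_comp]
  rfl

lemma shift_map_f_comp_shiftXIso_hom {K L : CochainComplex C ℤ} (f : K ⟶ L) (a i m : ℤ)
    (hi : i + a = m) :
    (f⟦a⟧').f i ≫ (L.shiftXIso a i m hi).hom = (K.shiftXIso a i m hi).hom ≫ f.f m := by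
  subst hi
  simp only [shiftXIso, HomologicalComplex.XIsoOfEq_rfl, Iso.refl_hom]
  erw [comp_id, id_comp]
  rfl

lemma shiftFunctorZero_inv_app_f_comp_shiftXIso_hom (K : CochainComplex C ℤ) (i : ℤ) :
    ((CategoryTheory.shiftFunctorZero (CochainComplex C ℤ) ℤ).inv.app K).f i ≫
      (K.shiftXIso 0 i i (add_zero i)).hom = 𝟙 _ := by
  rw [shiftFunctorZero_inv_app_f]
  simp only [shiftXIso]
  erw [HomologicalComplex.XIsoOfEq_hom_comp_XIsoOfEq_hom]
  rfl

lemma shiftFunctorZero_hom_app_f_eq_shiftXIso_hom (K : CochainComplex C ℤ) (i : ℤ) :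
    ((CategoryTheory.shiftFunctorZero (CochainComplex C ℤ) ℤ).hom.app K).f i =
      (K.shiftXIso 0 i i (add_zero i)).hom := by
  rw [shiftFunctorZero_hom_app_f]
  rfl

lemma shiftFunctorAdd_hom_app_f_comp_shiftXIso_hom (K : CochainComplex C ℤ) (a b i m n : ℤ)
    (h₁ : i + b = m) (h₂ : m + a = n) :
    ((CategoryTheory.shiftFunctorAdd (CochainComplex C ℤ) a b).hom.app K).f i ≫
      ((K⟦a⟧).shiftXIso b i m h₁).hom ≫ (K.shiftXIso a m n h₂).hom =
      (K.shiftXIso (a + b) i n (by lia)).hom := by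
  subst h₁ h₂
  rw [shiftFunctorAdd_hom_app_f]
  simp only [shiftXIso, XIsoOfEq_shift]
  erw [HomologicalComplex.XIsoOfEq_hom_comp_XIsoOfEq_hom,
    HomologicalComplex.XIsoOfEq_hom_comp_XIsoOfEq_hom]

lemma shiftFunctorAdd_inv_app_f_comp_shiftXIso_hom (K : CochainComplex C ℤ) (a b i m n : ℤ)
    (h₁ : i + b = m) (h₂ : m + a = n) :
    ((CategoryTheory.shiftFunctorAdd (CochainComplex C ℤ) a b).inv.app K).f i ≫
      (K.shiftXIso (a + b) i n (by lia)).hom =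
      ((K⟦a⟧).shiftXIso b i m h₁).hom ≫ (K.shiftXIso a m n h₂).hom := by
  rw [← shiftFunctorAdd_hom_app_f_comp_shiftXIso_hom K a b i m n h₁ h₂,
    ← HomologicalComplex.comp_f_assoc, Iso.inv_hom_id_app, HomologicalComplex.id_f]
  erw [id_comp]

end Shift

namespace mappingCone

variable {C : Type*} [Category C] [Preadditive C] [HasBinaryBiproducts C]
  {K₁ L₁ K₂ L₂ : CochainComplex C ℤ} (φ₁ : K₁ ⟶ L₁) (φ₂ : K₂ ⟶ L₂) (a : K₁ ⟶ K₂) (b : L₁ ⟶ L₂)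
  (comm : φ₁ ≫ b = a ≫ φ₂)

lemma inl_v_map_f (i j : ℤ) (h : i + (-1) = j) :
    (inl φ₁).v i j h ≫ (map φ₁ φ₂ a b comm).f j = a.f i ≫ (inl φ₂).v i j h := by
  simp [map]

lemma inr_f_map_f (i : ℤ) :
    (inr φ₁).f i ≫ (map φ₁ φ₂ a b comm).f i = b.f i ≫ (inr φ₂).f i := by
  simp [map]

end mappingCone

end CochainComplex

/-! ### The cone of a natural transformation, as a functor on complexes commuting with shifts -/

section Cone

variable {A B : Type*} [Category A] [Category B] [Preadditive A] [Preadditive B]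
  [HasBinaryBiproducts B] {U V : A ⥤ B} [U.Additive] [V.Additive] (α : U ⟶ V)

namespace CategoryTheory.NatTrans

open CochainComplex

/-- The functor on cochain complexes which sends `K` to the mapping cone of the morphism
`U K ⟶ V K` induced by a natural transformation `α : U ⟶ V` between additive functors. -/
noncomputable def coneFunctor : CochainComplex A ℤ ⥤ CochainComplex B ℤ where
  obj K := mappingCone ((NatTrans.mapHomologicalComplex α (ComplexShape.up ℤ)).app K)
  map f := mappingCone.map _ _ ((U.mapHomologicalComplex _).map f)
    ((V.mapHomologicalComplex _).map f)
    ((NatTrans.mapHomologicalComplex α (ComplexShape.up ℤ)).naturality f).symm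
  map_id K := by simp only [Functor.map_id, mappingCone.map_id]
  map_comp f g := by
    simp only [Functor.map_comp]
    exact mappingCone.map_comp _ _ _ _ _ _ _ _ _

namespace coneFunctor

variable (K : CochainComplex A ℤ)

/-- The inclusion of the first summand in a term of `(coneFunctor α).obj K`. -/
noncomputable def inlX (i j : ℤ) (h : j + 1 = i) : U.obj (K.X i) ⟶ (α.coneFunctor.obj K).X j :=
  (mappingCone.inl ((NatTrans.mapHomologicalComplex α (ComplexShape.up ℤ)).app K)).v i j (by lia)

/-- The inclusion of the second summand in a term of `(coneFunctor α).obj K`. -/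
noncomputable def inrX (i : ℤ) : V.obj (K.X i) ⟶ (α.coneFunctor.obj K).X i :=
  (mappingCone.inr ((NatTrans.mapHomologicalComplex α (ComplexShape.up ℤ)).app K)).f i

/-- The projection to the first summand from a term of `(coneFunctor α).obj K`. -/
noncomputable def fstX (i j : ℤ) (h : i + 1 = j) : (α.coneFunctor.obj K).X i ⟶ U.obj (K.X j) :=
  (mappingCone.fst ((NatTrans.mapHomologicalComplex α (ComplexShape.up ℤ)).app K)).1.v i j h

/-- The projection to the second summand from a term of `(coneFunctor α).obj K`. -/
noncomputable def sndX (i : ℤ) : (α.coneFunctor.obj K).X i ⟶ V.obj (K.X i) :=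
  (mappingCone.snd ((NatTrans.mapHomologicalComplex α (ComplexShape.up ℤ)).app K)).v i i
    (add_zero i)

@[simp]
lemma inlX_fstX (i j : ℤ) (h : j + 1 = i) : inlX α K i j h ≫ fstX α K j i h = 𝟙 _ :=
  mappingCone.inl_v_fst_v _ _ _ _

@[simp]
lemma inlX_fstX_assoc (i j : ℤ) (h : j + 1 = i) {Z : B} (f : _ ⟶ Z) :
    inlX α K i j h ≫ fstX α K j i h ≫ f = f := by
  rw [← assoc, inlX_fstX, id_comp]

@[simp]
lemma inlX_sndX (i j : ℤ) (h : j + 1 = i) : inlX α K i j h ≫ sndX α K j = 0 :=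
  mappingCone.inl_v_snd_v _ _ _ _

@[simp]
lemma inlX_sndX_assoc (i j : ℤ) (h : j + 1 = i) {Z : B} (f : _ ⟶ Z) :
    inlX α K i j h ≫ sndX α K j ≫ f = 0 := by
  rw [← assoc, inlX_sndX, zero_comp]

@[simp]
lemma inrX_fstX (i j : ℤ) (h : i + 1 = j) : inrX α K i ≫ fstX α K i j h = 0 :=
  mappingCone.inr_f_fst_v _ _ _ _

@[simp]
lemma inrX_fstX_assoc (i j : ℤ) (h : i + 1 = j) {Z : B} (f : _ ⟶ Z) :
    inrX α K i ≫ fstX α K i j h ≫ f = 0 := by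
  rw [← assoc, inrX_fstX, zero_comp]

@[simp]
lemma inrX_sndX (i : ℤ) : inrX α K i ≫ sndX α K i = 𝟙 _ :=
  mappingCone.inr_f_snd_v _ _

@[simp]
lemma inrX_sndX_assoc (i : ℤ) {Z : B} (f : _ ⟶ Z) :
    inrX α K i ≫ sndX α K i ≫ f = f := by
  rw [← assoc, inrX_sndX, id_comp]

variable {K} in
lemma hom_ext {i j : ℤ} (h : j + 1 = i) {Z : B} {f g : (α.coneFunctor.obj K).X j ⟶ Z}
    (h₁ : inlX α K i j h ≫ f = inlX α K i j h ≫ g) (h₂ : inrX α K j ≫ f = inrX α K j ≫ g) :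
    f = g :=
  mappingCone.ext_from _ i j h h₁ h₂

lemma id_eq (i j : ℤ) (h : j + 1 = i) :
    fstX α K j i h ≫ inlX α K i j h + sndX α K j ≫ inrX α K j = 𝟙 _ :=
  hom_ext α h (by simp) (by simp)

/-- The first summand is `(U K)⟦1⟧`, whence the minus sign on `U d`; `α` is the off-diagonal part of
the differential. -/
lemma inlX_d (i j k : ℤ) (h : j + 1 = i) (h' : i + 1 = k) :
    inlX α K i j h ≫ (α.coneFunctor.obj K).d j i =
      α.app (K.X i) ≫ inrX α K i - U.map (K.d i k) ≫ inlX α K k i h' :=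
  mappingCone.inl_v_d _ i j k (by lia) (by lia)

lemma inrX_d (i j : ℤ) :
    inrX α K i ≫ (α.coneFunctor.obj K).d i j = V.map (K.d i j) ≫ inrX α K j :=
  mappingCone.inr_f_d _ i j

variable {K} {L : CochainComplex A ℤ} (φ : K ⟶ L)

@[simp]
lemma inlX_map_f (i j : ℤ) (h : j + 1 = i) :
    inlX α K i j h ≫ (α.coneFunctor.map φ).f j = U.map (φ.f i) ≫ inlX α L i j h := 
  mappingCone.inl_v_map_f _ _ _ _
    ((NatTrans.mapHomologicalComplex α (ComplexShape.up ℤ)).naturality φ).symm i j (by lia)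

@[simp]
lemma inlX_map_f_assoc (i j : ℤ) (h : j + 1 = i) {Z : B} (f : _ ⟶ Z) :
    inlX α K i j h ≫ (α.coneFunctor.map φ).f j ≫ f = U.map (φ.f i) ≫ inlX α L i j h ≫ f := by
  rw [← assoc, inlX_map_f, assoc]

@[simp]
lemma inrX_map_f (i : ℤ) :
    inrX α K i ≫ (α.coneFunctor.map φ).f i = V.map (φ.f i) ≫ inrX α L i :=
  mappingCone.inr_f_map_f _ _ _ _
    ((NatTrans.mapHomologicalComplex α (ComplexShape.up ℤ)).naturality φ).symm i

@[simp]
lemma inrX_map_f_assoc (i : ℤ) {Z : B} (f : _ ⟶ Z) :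
    inrX α K i ≫ (α.coneFunctor.map φ).f i ≫ f = V.map (φ.f i) ≫ inrX α L i ≫ f := by
  rw [← assoc, inrX_map_f, assoc]

@[simp]
lemma map_f_fstX (i j : ℤ) (h : i + 1 = j) :
    (α.coneFunctor.map φ).f i ≫ fstX α L i j h = fstX α K i j h ≫ U.map (φ.f j) :=
  hom_ext α h (by simp) (by simp)

@[simp]
lemma map_f_fstX_assoc (i j : ℤ) (h : i + 1 = j) {Z : B} (f : _ ⟶ Z) :
    (α.coneFunctor.map φ).f i ≫ fstX α L i j h ≫ f = fstX α K i j h ≫ U.map (φ.f j) ≫ f := by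
  rw [← assoc, map_f_fstX, assoc]

@[simp]
lemma map_f_sndX (i : ℤ) :
    (α.coneFunctor.map φ).f i ≫ sndX α L i = sndX α K i ≫ V.map (φ.f i) :=
  hom_ext α rfl (by simp) (by simp)

@[simp]
lemma map_f_sndX_assoc (i : ℤ) {Z : B} (f : _ ⟶ Z) :
    (α.coneFunctor.map φ).f i ≫ sndX α L i ≫ f = sndX α K i ≫ V.map (φ.f i) ≫ f := by
  rw [← assoc, map_f_sndX, assoc]

section Shift

open CochainComplex

variable (K) in
/-- The compatibility of `coneFunctor` with the shift, in each degree. -/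
noncomputable def shiftXIso' (a i j : ℤ) (h : i + a = j) :
    (α.coneFunctor.obj (K⟦a⟧)).X i ≅ (α.coneFunctor.obj K).X j where
  -- Shifting the cone multiplies its whole differential by `(-1)^a`, including `α`, while in the
  -- cone over `K⟦a⟧` only the differentials of `K` acquire the sign. Rescaling the `U`-summand by
  -- `(-1)^a` corrects `α`.
  hom := a.negOnePow • fstX α (K⟦a⟧) i _ rfl ≫
        U.map (K.shiftXIso a (i + 1) (j + 1) (by lia)).hom ≫ inlX α K _ _ rfl +
      sndX α (K⟦a⟧) i ≫ V.map (K.shiftXIso a i j h).hom ≫ inrX α K j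
  inv := a.negOnePow • fstX α K j _ rfl ≫
        U.map (K.shiftXIso a (i + 1) (j + 1) (by lia)).inv ≫ inlX α (K⟦a⟧) _ _ rfl +
      sndX α K j ≫ V.map (K.shiftXIso a i j h).inv ≫ inrX α (K⟦a⟧) i
  hom_inv_id := hom_ext α rfl
    (by simp [-shiftFunctor_obj_X', smul_smul, ← Functor.map_comp_assoc])
    (by simp [-shiftFunctor_obj_X', ← Functor.map_comp_assoc])
  inv_hom_id := hom_ext α rfl
    (by simp [-shiftFunctor_obj_X', smul_smul, ← Functor.map_comp_assoc])
    (by simp [-shiftFunctor_obj_X', ← Functor.map_comp_assoc])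

lemma inlX_shiftXIso'_hom (a i j i' j' : ℤ) (h : j + 1 = i) (h' : i + a = i') (h'' : j + a = j') :
    inlX α (K⟦a⟧) i j h ≫ (shiftXIso' α K a j j' h'').hom =
      a.negOnePow • U.map (K.shiftXIso a i i' h').hom ≫ inlX α K i' j' (by lia) := by
  obtain rfl : i' = j' + 1 := by lia
  subst h
  simp [-shiftFunctor_obj_X', shiftXIso']

lemma inrX_shiftXIso'_hom (a i i' : ℤ) (h : i + a = i') :
    inrX α (K⟦a⟧) i ≫ (shiftXIso' α K a i i' h).hom =
      V.map (K.shiftXIso a i i' h).hom ≫ inrX α K i' := by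
  simp [-shiftFunctor_obj_X', shiftXIso']

variable (K) in
/-- The compatibility of `coneFunctor` with the shift, on objects. -/
noncomputable def shiftObjIso (a : ℤ) :
    α.coneFunctor.obj (K⟦a⟧) ≅ (α.coneFunctor.obj K)⟦a⟧ :=
  HomologicalComplex.Hom.isoOfComponents
    (fun i => shiftXIso' α K a i _ rfl ≪≫ (CochainComplex.shiftXIso _ a i _ rfl).symm) (by
      rintro i _ rfl
      rw [← cancel_mono (CochainComplex.shiftXIso _ a (i + 1) _ rfl).hom]
      have h₁ := shift_d_comp_shiftXIso_hom K a (i + 1) (i + 1 + 1) _ _ rfl rfl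
      have h₂ := shift_d_comp_shiftXIso_hom K a i (i + 1) _ _ rfl rfl
      simp only [Iso.trans_hom, Iso.symm_hom, assoc, Iso.inv_hom_id, comp_id,
        shift_d_comp_shiftXIso_hom _ a i (i + 1) _ _ rfl rfl, Linear.comp_units_smul,
        Iso.inv_hom_id_assoc]
      refine hom_ext α rfl ?_ ?_
      · rw [Linear.comp_units_smul,
          reassoc_of% (inlX_shiftXIso'_hom (K := K) α a (i + 1) i _ _ rfl rfl rfl), reassoc_of% (inlX_d α (K⟦a⟧) _ i _ rfl rfl),
          sub_comp, assoc, assoc, inrX_shiftXIso'_hom,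
          inlX_shiftXIso'_hom α a (i + 1 + 1) (i + 1) _ _ rfl rfl rfl,
          Linear.units_smul_comp, smul_smul, Int.units_mul_self, one_smul, assoc,
          inlX_d α K _ _ _ _ (by lia : i + 1 + a + 1 = i + 1 + 1 + a), comp_sub,
          Linear.comp_units_smul, ← Functor.map_comp_assoc, ← Functor.map_comp_assoc, h₁,
          Functor.map_units_smul, Linear.units_smul_comp, smul_smul, Int.units_mul_self, one_smul]
        simp
      · rw [Linear.comp_units_smul, reassoc_of% (inrX_shiftXIso'_hom (K := K) α), reassoc_of% (inrX_d α),
          inrX_shiftXIso'_hom, inrX_d, ← Functor.map_comp_assoc, ← Functor.map_comp_assoc, h₂,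
          Functor.map_units_smul, Linear.units_smul_comp])

lemma inlX_shiftObjIso_hom_f (a i j i' j' : ℤ) (h : j + 1 = i) (h' : i + a = i')
    (h'' : j + a = j') :
    inlX α (K⟦a⟧) i j h ≫ (shiftObjIso α K a).hom.f j ≫
        (CochainComplex.shiftXIso _ a j j' h'').hom =
      a.negOnePow • U.map (K.shiftXIso a i i' h').hom ≫ inlX α K i' j' (by lia) := by
  subst h''
  simp [-shiftFunctor_obj_X', shiftObjIso, inlX_shiftXIso'_hom α a i j i' _ h h' rfl]

lemma inrX_shiftObjIso_hom_f (a i i' : ℤ) (h : i + a = i') :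
    inrX α (K⟦a⟧) i ≫ (shiftObjIso α K a).hom.f i ≫
        (CochainComplex.shiftXIso _ a i i' h).hom =
      V.map (K.shiftXIso a i i' h).hom ≫ inrX α K i' := by
  subst h
  simp [-shiftFunctor_obj_X', shiftObjIso, inrX_shiftXIso'_hom]

/-- The compatibility of `coneFunctor` with the shift. -/
noncomputable def shiftIso (a : ℤ) :
    shiftFunctor (CochainComplex A ℤ) a ⋙ α.coneFunctor ≅
      α.coneFunctor ⋙ shiftFunctor (CochainComplex B ℤ) a :=
  NatIso.ofComponents (fun K => shiftObjIso α K a) (by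
    intro K L f
    ext i
    rw [← cancel_mono (CochainComplex.shiftXIso _ a i _ rfl).hom]
    dsimp only [Functor.comp_map, HomologicalComplex.comp_f]
    rw [assoc, assoc]
    refine hom_ext α rfl ?_ ?_
    · rw [inlX_map_f_assoc, inlX_shiftObjIso_hom_f α _ _ _ _ _ _ rfl,
        shift_map_f_comp_shiftXIso_hom, reassoc_of% (inlX_shiftObjIso_hom_f (K := K) α a _ i _ _ rfl rfl rfl),
        Linear.comp_units_smul, Linear.units_smul_comp, assoc, inlX_map_f,
        ← Functor.map_comp_assoc, ← Functor.map_comp_assoc, shift_map_f_comp_shiftXIso_hom]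
    · rw [inrX_map_f_assoc, inrX_shiftObjIso_hom_f,
        shift_map_f_comp_shiftXIso_hom, reassoc_of% (inrX_shiftObjIso_hom_f (K := K) α a i _ rfl), inrX_map_f,
        ← Functor.map_comp_assoc, ← Functor.map_comp_assoc, shift_map_f_comp_shiftXIso_hom])

/-- On the `U`-summand the two coherence laws amount to `(-1)^0 = 1` and `(-1)^(a+b) = (-1)^a
(-1)^b`; the `V`-summand carries no sign. -/
noncomputable instance : α.coneFunctor.CommShift ℤ where
  commShiftIso := shiftIso α
  commShiftIso_zero := by
    ext K i
    rw [Functor.CommShift.isoZero_hom_app, ← cancel_mono (CochainComplex.shiftXIso _ 0 i i (add_zero i)).hom]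
    dsimp only [HomologicalComplex.comp_f]
    rw [assoc]
    erw [shiftFunctorZero_inv_app_f_comp_shiftXIso_hom]
    refine hom_ext α rfl ?_ ?_
    · refine (inlX_shiftObjIso_hom_f α 0 _ i _ i rfl (add_zero _) (add_zero i)).trans ?_
      rw [inlX_map_f_assoc, shiftFunctorZero_hom_app_f_eq_shiftXIso_hom]
      erw [comp_id]
      rw [Int.negOnePow_zero, one_smul]
    · refine (inrX_shiftObjIso_hom_f α 0 _ i (add_zero i)).trans ?_
      rw [inrX_map_f_assoc, shiftFunctorZero_hom_app_f_eq_shiftXIso_hom]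
      erw [comp_id]
  commShiftIso_add a b := by
    ext K i
    rw [Functor.CommShift.isoAdd_hom_app, ← cancel_mono (CochainComplex.shiftXIso _ (a + b) i _ rfl).hom]
    dsimp only [HomologicalComplex.comp_f]
    simp only [assoc]
    erw [shiftFunctorAdd_inv_app_f_comp_shiftXIso_hom (α.coneFunctor.obj K) a b i _ _ rfl
      (by lia : i + b + a = i + (a + b)), reassoc_of% (shift_map_f_comp_shiftXIso_hom (C := B))]
    refine hom_ext α rfl ?_ ?_
    · refine (inlX_shiftObjIso_hom_f α (a + b) _ i _ _ rfl rfl rfl).trans ?_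
      rw [inlX_map_f_assoc]
      erw [reassoc_of% (inlX_shiftObjIso_hom_f (K := K⟦a⟧) α b _ i _ _ rfl rfl rfl)]
      rw [Linear.units_smul_comp, assoc]
      erw [inlX_shiftObjIso_hom_f α a _ _ _ _ _
        (by lia : i + 1 + b + a = i + 1 + (a + b)) (by lia : i + b + a = i + (a + b))]
      rw [Linear.comp_units_smul, Linear.comp_units_smul, Linear.comp_units_smul, smul_smul,
        ← Functor.map_comp_assoc, ← Functor.map_comp_assoc, assoc,
        shiftFunctorAdd_hom_app_f_comp_shiftXIso_hom, Int.negOnePow_add, mul_comm]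
    · refine (inrX_shiftObjIso_hom_f α (a + b) i _ rfl).trans ?_
      rw [inrX_map_f_assoc]
      erw [reassoc_of% (inrX_shiftObjIso_hom_f (K := K⟦a⟧) α b i _ rfl)]
      erw [inrX_shiftObjIso_hom_f α a _ _ (by lia : i + b + a = i + (a + b))]
      rw [← Functor.map_comp_assoc, ← Functor.map_comp_assoc, assoc,
        shiftFunctorAdd_hom_app_f_comp_shiftXIso_hom]

end Shift

end coneFunctor

end CategoryTheory.NatTrans

end Cone

/-! ### The cone functor preserves mapping cone triangles -/

open Limits Category Preadditive Pretriangulated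

namespace CochainComplex.mappingCone

variable {C D : Type*} [Category C] [Preadditive C] [Category D] [Preadditive D]
  [HasBinaryBiproducts C] {K L : CochainComplex C ℤ} (φ : K ⟶ L)

/-- The third morphism of the triangle attached to a morphism `φ`. -/
noncomputable def toShift : mappingCone φ ⟶ K⟦(1 : ℤ)⟧ := (triangle φ).mor₃

/-- The connecting map is minus the projection to `K⟦1⟧`; this sign must match those of `shiftXIso'`
and `mappingConeXIso`. -/
lemma inl_v_toShift_f (i j : ℤ) (h : i + (-1) = j) :
    (inl φ).v i j h ≫ (toShift φ).f j ≫ (K.shiftXIso 1 j i (by lia)).hom = -𝟙 _ := by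
  have : (inl φ).v i j h ≫ (toShift φ).f j = -(K.shiftXIso 1 j i (by lia)).inv :=
    inl_v_triangle_mor₃_f φ i j h
  rw [← assoc, this, neg_comp, neg_inj]
  exact Iso.inv_hom_id _

lemma inr_f_toShift_f (j : ℤ) : (inr φ).f j ≫ (toShift φ).f j = 0 :=
  inr_f_triangle_mor₃_f φ j

section

variable (U : C ⥤ D) (i j : ℤ) (h : j + 1 = i)

omit [Preadditive D] in
@[simp]
lemma map_inl_v_map_fst_v_assoc (h' : i + (-1) = j) {Z : D} (f : _ ⟶ Z) :
    U.map ((inl φ).v i j h') ≫ U.map ((fst φ).1.v j i h) ≫ f = f := by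
  rw [← U.map_comp_assoc, inl_v_fst_v, U.map_id, id_comp]

omit [Preadditive D] in
@[simp]
lemma map_inr_f_map_snd_v_assoc {Z : D} (f : _ ⟶ Z) :
    U.map ((inr φ).f j) ≫ U.map ((snd φ).v j j (add_zero j)) ≫ f = f := by
  rw [← U.map_comp_assoc, inr_f_snd_v, U.map_id, id_comp]

variable [U.Additive]

@[simp]
lemma map_inl_v_map_snd_v_assoc (h' : i + (-1) = j) {Z : D} (f : _ ⟶ Z) :
    U.map ((inl φ).v i j h') ≫ U.map ((snd φ).v j j (add_zero j)) ≫ f = 0 := by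
  rw [← U.map_comp_assoc, inl_v_snd_v, U.map_zero, zero_comp]

@[simp]
lemma map_inr_f_map_fst_v_assoc {Z : D} (f : _ ⟶ Z) :
    U.map ((inr φ).f j) ≫ U.map ((fst φ).1.v j i h) ≫ f = 0 := by
  rw [← U.map_comp_assoc, inr_f_fst_v, U.map_zero, zero_comp]

end

/-- An additive functor preserves the decomposition of the identity of a term of the cone, so maps
out of its image can be tested on the two images. -/
lemma map_hom_ext (U : C ⥤ D) [U.Additive] {i j : ℤ} (h : i + (-1) = j) {Z : D}
    {f g : U.obj ((mappingCone φ).X j) ⟶ Z}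
    (h₁ : U.map ((inl φ).v i j h) ≫ f = U.map ((inl φ).v i j h) ≫ g)
    (h₂ : U.map ((inr φ).f j) ≫ f = U.map ((inr φ).f j) ≫ g) : f = g := by
  have H := congr_arg U.map (id_X φ j i (by lia))
  rw [U.map_id, U.map_add, U.map_comp, U.map_comp] at H
  rw [← id_comp f, ← id_comp g, ← H, add_comp, add_comp, assoc, assoc, assoc, assoc, h₁, h₂]

end CochainComplex.mappingCone

namespace CategoryTheory.NatTrans.coneFunctor

open CochainComplex mappingCone

variable {A B : Type*} [Category A] [Category B] [Preadditive A] [Preadditive B]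
  [HasBinaryBiproducts A] [HasBinaryBiproducts B] {U V : A ⥤ B} [U.Additive] [V.Additive]
  (α : U ⟶ V) {K L : CochainComplex A ℤ} (φ : K ⟶ L)

lemma hom_ext_mappingCone {i j k : ℤ} (h : j + 1 = i) (h' : i + 1 = k) {Z : B}
    {f g : (α.coneFunctor.obj (mappingCone φ)).X j ⟶ Z}
    (h₁ : U.map ((inl φ).v k i (by lia)) ≫ inlX α _ i j h ≫ f =
      U.map ((inl φ).v k i (by lia)) ≫ inlX α _ i j h ≫ g)
    (h₂ : U.map ((inr φ).f i) ≫ inlX α _ i j h ≫ f = U.map ((inr φ).f i) ≫ inlX α _ i j h ≫ g)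
    (h₃ : V.map ((inl φ).v i j (by lia)) ≫ inrX α _ j ≫ f =
      V.map ((inl φ).v i j (by lia)) ≫ inrX α _ j ≫ g)
    (h₄ : V.map ((inr φ).f j) ≫ inrX α _ j ≫ f = V.map ((inr φ).f j) ≫ inrX α _ j ≫ g) :
    f = g :=
  hom_ext α h (map_hom_ext φ U _ h₁ h₂) (map_hom_ext φ V _ h₃ h₄)

omit [HasBinaryBiproducts A] in
lemma hom_ext_mappingCone_map {i j k : ℤ} (h : j + 1 = i) (h' : i + 1 = k) {Z : B}
    {f g : (mappingCone (α.coneFunctor.map φ)).X j ⟶ Z}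
    (h₁ : inlX α K k i h' ≫ (inl (α.coneFunctor.map φ)).v i j (by lia) ≫ f =
      inlX α K k i h' ≫ (inl (α.coneFunctor.map φ)).v i j (by lia) ≫ g)
    (h₂ : inrX α K i ≫ (inl (α.coneFunctor.map φ)).v i j (by lia) ≫ f =
      inrX α K i ≫ (inl (α.coneFunctor.map φ)).v i j (by lia) ≫ g)
    (h₃ : inlX α L i j h ≫ (inr (α.coneFunctor.map φ)).f j ≫ f =
      inlX α L i j h ≫ (inr (α.coneFunctor.map φ)).f j ≫ g)
    (h₄ : inrX α L j ≫ (inr (α.coneFunctor.map φ)).f j ≫ f =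
      inrX α L j ≫ (inr (α.coneFunctor.map φ)).f j ≫ g) :
    f = g :=
  mappingCone.ext_from _ i j h (hom_ext α h' h₁ h₂) (hom_ext α h h₃ h₄)

/-- The isomorphism between the image of a mapping cone by `coneFunctor` and the mapping cone
of the image, in each degree. -/
noncomputable def mappingConeXIso (i j k : ℤ) (h : j + 1 = i) (h' : i + 1 = k) :
    (α.coneFunctor.obj (mappingCone φ)).X j ≅ (mappingCone (α.coneFunctor.map φ)).X j where
  -- Both sides have the summands `U K`, `U L`, `V K`, `V L`. Forming the two cones in the other
  -- order interchanges two shifts, and only `U K` is shifted twice; hence the single minus sign.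
  hom := -fstX α _ j i h ≫ U.map ((fst φ).1.v i k h') ≫ inlX α K k i h' ≫
        (inl (α.coneFunctor.map φ)).v i j (by lia) +
      fstX α _ j i h ≫ U.map ((snd φ).v i i (add_zero i)) ≫ inlX α L i j h ≫
        (inr (α.coneFunctor.map φ)).f j +
      sndX α _ j ≫ V.map ((fst φ).1.v j i h) ≫ inrX α K i ≫
        (inl (α.coneFunctor.map φ)).v i j (by lia) +
      sndX α _ j ≫ V.map ((snd φ).v j j (add_zero j)) ≫ inrX α L j ≫
        (inr (α.coneFunctor.map φ)).f j
  inv := -(fst (α.coneFunctor.map φ)).1.v j i h ≫ fstX α K i k h' ≫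
        U.map ((inl φ).v k i (by lia)) ≫ inlX α _ i j h +
      (fst (α.coneFunctor.map φ)).1.v j i h ≫ sndX α K i ≫
        V.map ((inl φ).v i j (by lia)) ≫ inrX α _ j +
      (snd (α.coneFunctor.map φ)).v j j (add_zero j) ≫ fstX α L j i h ≫
        U.map ((inr φ).f i) ≫ inlX α _ i j h +
      (snd (α.coneFunctor.map φ)).v j j (add_zero j) ≫ sndX α L j ≫
        V.map ((inr φ).f j) ≫ inrX α _ j
  hom_inv_id := by
    apply hom_ext_mappingCone α φ h h' <;> simp
  inv_hom_id := by
    apply hom_ext_mappingCone_map α φ h h' <;> simp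

section

variable (i j k : ℤ) (h : j + 1 = i) (h' : i + 1 = k)

lemma map_inl_inlX_mappingConeXIso_hom :
    U.map ((inl φ).v k i (by lia)) ≫ inlX α _ i j h ≫ (mappingConeXIso α φ i j k h h').hom =
      -inlX α K k i h' ≫ (inl (α.coneFunctor.map φ)).v i j (by lia) := by
  simp [mappingConeXIso]

lemma map_inr_inlX_mappingConeXIso_hom :
    U.map ((inr φ).f i) ≫ inlX α _ i j h ≫ (mappingConeXIso α φ i j k h h').hom =
      inlX α L i j h ≫ (inr (α.coneFunctor.map φ)).f j := by
  simp [mappingConeXIso]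

lemma map_inl_inrX_mappingConeXIso_hom :
    V.map ((inl φ).v i j (by lia)) ≫ inrX α _ j ≫ (mappingConeXIso α φ i j k h h').hom =
      inrX α K i ≫ (inl (α.coneFunctor.map φ)).v i j (by lia) := by
  simp [mappingConeXIso]

lemma map_inr_inrX_mappingConeXIso_hom :
    V.map ((inr φ).f j) ≫ inrX α _ j ≫ (mappingConeXIso α φ i j k h h').hom =
      inrX α L j ≫ (inr (α.coneFunctor.map φ)).f j := by
  simp [mappingConeXIso]

/-- Both complexes are total complexes of the square `U K ⟶ U L`, `V K ⟶ V L`, so the check is made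
on the four summands. On `U K` it uses naturality of `α` and the minus sign of `mappingConeXIso`. -/
lemma mappingConeXIso_hom_d (l : ℤ) (h'' : k + 1 = l) :
    (mappingConeXIso α φ i j k h h').hom ≫ (mappingCone (α.coneFunctor.map φ)).d j i =
      (α.coneFunctor.obj (mappingCone φ)).d j i ≫ (mappingConeXIso α φ k i l h' h'').hom := by
  have d₁ := mappingCone.inl_v_d φ k i l (by lia) (by lia)
  have d₂ := mappingCone.inl_v_d φ i j k (by lia) (by lia)
  have D := mappingCone.inl_v_d (α.coneFunctor.map φ) i j k (by lia) (by lia)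
  apply hom_ext_mappingCone α φ h h'
  · rw [reassoc_of% (map_inl_inlX_mappingConeXIso_hom α φ i j k h h'),
      reassoc_of% (inlX_d α (mappingCone φ) i j k h h'), neg_comp, assoc, D]
    simp only [comp_sub, sub_comp, assoc, inlX_map_f_assoc, reassoc_of% (inlX_d α K k i l h' h''),
      ← U.map_comp_assoc, d₁, Functor.map_sub]
    simp only [U.map_comp, assoc, map_inl_inlX_mappingConeXIso_hom α φ k i l h' h'',
      map_inr_inlX_mappingConeXIso_hom α φ k i l h' h'', comp_neg]
    simp
    rw [map_inl_inrX_mappingConeXIso_hom α φ k i l h' h'']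
    abel
  · rw [reassoc_of% (map_inr_inlX_mappingConeXIso_hom α φ i j k h h'),
      reassoc_of% (inlX_d α (mappingCone φ) i j k h h'), mappingCone.inr_f_d]
    simp only [comp_sub, sub_comp, assoc, reassoc_of% (inlX_d α L i j k h h'),
      reassoc_of% (α.naturality ((inr φ).f i)),
      map_inr_inrX_mappingConeXIso_hom α φ k i l h' h'', ← U.map_comp_assoc, mappingCone.inr_f_d]
    simp only [U.map_comp, assoc, map_inr_inlX_mappingConeXIso_hom α φ k i l h' h'']
  · rw [reassoc_of% (map_inl_inrX_mappingConeXIso_hom α φ i j k h h'),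
      reassoc_of% (inrX_d α (mappingCone φ)), D]
    simp only [comp_sub, reassoc_of% (inrX_d α K), ← V.map_comp_assoc, d₂, V.map_sub]
    simp only [sub_comp, V.map_comp, assoc, map_inl_inrX_mappingConeXIso_hom α φ k i l h' h'',
      map_inr_inrX_mappingConeXIso_hom α φ k i l h' h'', inrX_map_f_assoc]
  · rw [reassoc_of% (map_inr_inrX_mappingConeXIso_hom α φ i j k h h'),
      reassoc_of% (inrX_d α (mappingCone φ)), mappingCone.inr_f_d, reassoc_of% (inrX_d α L),
      ← V.map_comp_assoc, mappingCone.inr_f_d, V.map_comp, assoc,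
      map_inr_inrX_mappingConeXIso_hom α φ k i l h' h'']

end

/-- The image of a mapping cone by `coneFunctor` identifies to the mapping cone of the image. -/
noncomputable def mappingConeIso :
    α.coneFunctor.obj (mappingCone φ) ≅ mappingCone (α.coneFunctor.map φ) :=
  HomologicalComplex.Hom.isoOfComponents
    (fun j => mappingConeXIso α φ (j + 1) j (j + 1 + 1) rfl rfl) (by
      rintro j _ rfl
      exact mappingConeXIso_hom_d α φ _ _ _ _ _ _ rfl)

lemma mappingConeIso_hom_f (i j k : ℤ) (h : j + 1 = i) (h' : i + 1 = k) :
    (mappingConeIso α φ).hom.f j = (mappingConeXIso α φ i j k h h').hom := by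
  subst h h'
  rfl

lemma map_inr_mappingConeIso_hom :
    α.coneFunctor.map (inr φ) ≫ (mappingConeIso α φ).hom = inr (α.coneFunctor.map φ) := by
  ext j
  refine hom_ext α rfl ?_ ?_
  · rw [HomologicalComplex.comp_f, inlX_map_f_assoc, mappingConeIso_hom_f α φ _ _ _ rfl rfl]
    exact map_inr_inlX_mappingConeXIso_hom α φ _ _ _ rfl rfl
  · rw [HomologicalComplex.comp_f, inrX_map_f_assoc, mappingConeIso_hom_f α φ _ _ _ rfl rfl]
    exact map_inr_inrX_mappingConeXIso_hom α φ _ _ _ rfl rfl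

/-- On `U K` the signs balance: those of `mappingConeXIso` and `toShift` on one side, those of
`toShift` and of the shift isomorphism `(-1)^1` on the other. -/
lemma mappingConeIso_hom_toShift :
    (mappingConeIso α φ).hom ≫ toShift (α.coneFunctor.map φ) =
      α.coneFunctor.map (toShift φ) ≫ (shiftObjIso α K 1).hom := by
  ext j
  rw [← cancel_mono (shiftXIso _ 1 j _ rfl).hom]
  have t₁ := inl_v_toShift_f φ (j + 1 + 1) (j + 1) (by lia)
  have t₂ := inl_v_toShift_f φ (j + 1) j (by lia)
  have T := inl_v_toShift_f (α.coneFunctor.map φ) (j + 1) j (by lia)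
  have s₁ := inlX_shiftObjIso_hom_f (K := K) α 1 _ j _ _ rfl rfl rfl
  have s₂ := inrX_shiftObjIso_hom_f (K := K) α 1 j _ rfl
  rw [HomologicalComplex.comp_f, HomologicalComplex.comp_f, assoc, assoc,
    mappingConeIso_hom_f α φ _ _ _ rfl rfl]
  refine hom_ext_mappingCone α φ rfl rfl ?_ ?_ ?_ ?_
  · rw [inlX_map_f_assoc, reassoc_of% (map_inl_inlX_mappingConeXIso_hom α φ (j + 1) j _ rfl rfl),
      s₁, neg_comp, assoc, T, comp_neg, comp_id, neg_neg, Int.negOnePow_one, Units.neg_smul,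
      one_smul, comp_neg, comp_neg, ← U.map_comp_assoc, ← U.map_comp_assoc, assoc, t₁, U.map_neg,
      U.map_id, neg_comp, id_comp, neg_neg]
  · rw [inlX_map_f_assoc, reassoc_of% (map_inr_inlX_mappingConeXIso_hom α φ (j + 1) j _ rfl rfl),
      ← U.map_comp_assoc, inr_f_toShift_f, U.map_zero, zero_comp,
      reassoc_of% (inr_f_toShift_f (α.coneFunctor.map φ) j), zero_comp, comp_zero]
  · rw [inrX_map_f_assoc, reassoc_of% (map_inl_inrX_mappingConeXIso_hom α φ (j + 1) j _ rfl rfl),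
      s₂, T, comp_neg, comp_id, ← V.map_comp_assoc, ← V.map_comp_assoc, assoc, t₂, V.map_neg, V.map_id,
      neg_comp, id_comp]
  · rw [inrX_map_f_assoc, reassoc_of% (map_inr_inrX_mappingConeXIso_hom α φ (j + 1) j _ rfl rfl),
      ← V.map_comp_assoc, inr_f_toShift_f, V.map_zero, zero_comp,
      reassoc_of% (inr_f_toShift_f (α.coneFunctor.map φ) j), zero_comp, comp_zero]

/-- The image by `coneFunctor` of the triangle associated to a morphism `φ` identifies to
the triangle associated to the image of `φ`. -/
noncomputable def mapTriangleIso :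
    α.coneFunctor.mapTriangle.obj (triangle φ) ≅ triangle (α.coneFunctor.map φ) :=
  Triangle.isoMk _ _ (Iso.refl _) (Iso.refl _) (mappingConeIso α φ)
    ((comp_id _).trans (id_comp _).symm)
    ((map_inr_mappingConeIso_hom α φ).trans (id_comp _).symm)
    (by
      refine Eq.trans ?_ (mappingConeIso_hom_toShift α φ).symm
      refine (congr_arg _ ?_).trans (comp_id _)
      exact Functor.map_id _ _)

end CategoryTheory.NatTrans.coneFunctor

/-! ### Descent to derived categories -/

open Limits Category Preadditive Pretriangulated

namespace CochainComplex.mappingCone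

variable {C : Type*} [Category C] [Abelian C]

/-- A morphism of mapping cones induced by two quasi-isomorphisms is a quasi-isomorphism. -/
lemma quasiIso_map {K₁ L₁ K₂ L₂ : CochainComplex C ℤ} (φ₁ : K₁ ⟶ L₁) (φ₂ : K₂ ⟶ L₂)
    (a : K₁ ⟶ K₂) (b : L₁ ⟶ L₂) (comm : φ₁ ≫ b = a ≫ φ₂) [QuasiIso a] [QuasiIso b] :
    QuasiIso (map φ₁ φ₂ a b comm) := by
  -- Any model of the derived category detects quasi-isomorphisms, and there a morphism of
  -- distinguished triangles that is invertible on two vertices is invertible on the third.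
  let := HasDerivedCategory.standard C
  rw [← DerivedCategory.isIso_Q_map_iff_quasiIso]
  exact isIso₃_of_isIso₁₂ (DerivedCategory.Q.mapTriangle.map (triangleMap φ₁ φ₂ a b comm))
    (DerivedCategory.mappingCone_triangle_distinguished φ₁)
    (DerivedCategory.mappingCone_triangle_distinguished φ₂)
    (inferInstanceAs (IsIso (DerivedCategory.Q.map a)))
    (inferInstanceAs (IsIso (DerivedCategory.Q.map b)))

end CochainComplex.mappingCone

namespace CategoryTheory

/-- Exactness of `U` and `V` makes `U φ` and `V φ` quasi-isomorphisms, and cones preserve this. -/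
lemma NatTrans.coneFunctor.quasiIso_map {A B : Type*} [Category A] [Category B] [Abelian A]
    [Abelian B] {U V : A ⥤ B} [U.Additive] [V.Additive] [U.PreservesHomology]
    [V.PreservesHomology] (α : U ⟶ V) {K L : CochainComplex A ℤ} (φ : K ⟶ L) [QuasiIso φ] :
    QuasiIso (α.coneFunctor.map φ) :=
  CochainComplex.mappingCone.quasiIso_map _ _ _ _
    ((NatTrans.mapHomologicalComplex α (ComplexShape.up ℤ)).naturality φ).symm

/-- Two functors whose composites in both directions are equivalences are equivalences. -/
lemma Functor.isEquivalence_of_comp_iso {C D : Type*} [Category C] [Category D]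
    (F : C ⥤ D) (G : D ⥤ C) {S : C ⥤ C} {T : D ⥤ D} [S.IsEquivalence] [T.IsEquivalence]
    (e : F ⋙ G ≅ S) (e' : G ⋙ F ≅ T) : F.IsEquivalence := by
  have : F.Faithful := Functor.Faithful.of_comp_iso e
  have : G.Faithful := Functor.Faithful.of_comp_iso e'
  have : (F ⋙ G).Full := Functor.Full.of_iso e.symm
  -- A morphism between objects in the image of `F` is lifted after applying `G`, and faithfulness
  -- of `G` shows that the lift is correct.
  have : F.Full := Functor.Full.of_comp_faithful F G
  have : F.EssSurj := ⟨fun Y => ⟨G.obj (T.objPreimage Y),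
    ⟨e'.app _ ≪≫ T.objObjPreimageIso Y⟩⟩⟩
  exact {}

/-- A triangulated functor which is an equivalence is a triangulated equivalence. -/
lemma triangulatedEquivalent_of_isEquivalence {C D : Type*} [Category C] [Category D]
    [HasZeroObject C] [HasZeroObject D] [Preadditive C] [Preadditive D]
    [HasShift C ℤ] [HasShift D ℤ]
    [∀ n : ℤ, (shiftFunctor C n).Additive] [∀ n : ℤ, (shiftFunctor D n).Additive]
    [Pretriangulated C] [Pretriangulated D] (F : C ⥤ D) [h : F.CommShift ℤ]
    [hF : F.IsTriangulated] [F.IsEquivalence] : TriangulatedEquivalent C D :=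
  let : F.asEquivalence.functor.CommShift ℤ := h
  let : F.asEquivalence.inverse.CommShift ℤ := F.asEquivalence.commShiftInverse ℤ
  have : F.asEquivalence.CommShift ℤ := F.asEquivalence.commShift_of_functor ℤ
  ⟨F.asEquivalence, inferInstance, inferInstance, Equivalence.IsTriangulated.mk' _ hF⟩

/-- A functor between cochain complexes which commutes with the shift, preserves
quasi-isomorphisms and mapping cones induces a triangulated equivalence on derived categories
if there is a functor in the other direction such that both composites
induce the shift functor. -/
lemma triangulatedEquivalent_derivedCategory {A : Type*} {B : Type*} [Category A] [Category B]
    [Abelian A] [Abelian B] [HasDerivedCategory.{w} A] [HasDerivedCategory.{w'} B]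
    (F : CochainComplex A ℤ ⥤ CochainComplex B ℤ) (G : CochainComplex B ℤ ⥤ CochainComplex A ℤ)
    [F.CommShift ℤ]
    (hF : ∀ ⦃K L : CochainComplex A ℤ⦄ (φ : K ⟶ L), QuasiIso φ → QuasiIso (F.map φ))
    (hG : ∀ ⦃K L : CochainComplex B ℤ⦄ (φ : K ⟶ L), QuasiIso φ → QuasiIso (G.map φ))
    (e : ∀ ⦃K L : CochainComplex A ℤ⦄ (φ : K ⟶ L),
      F.mapTriangle.obj (CochainComplex.mappingCone.triangle φ) ≅
        CochainComplex.mappingCone.triangle (F.map φ))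
    (e₁ : (F ⋙ G) ⋙ DerivedCategory.Q ≅
      shiftFunctor (CochainComplex A ℤ) (1 : ℤ) ⋙ DerivedCategory.Q)
    (e₂ : (G ⋙ F) ⋙ DerivedCategory.Q ≅
      shiftFunctor (CochainComplex B ℤ) (1 : ℤ) ⋙ DerivedCategory.Q) :
    TriangulatedEquivalent (DerivedCategory A) (DerivedCategory B) := by
  let WA := HomologicalComplex.quasiIso A (ComplexShape.up ℤ)
  let WB := HomologicalComplex.quasiIso B (ComplexShape.up ℤ)
  have hF' : WA.IsInvertedBy (F ⋙ DerivedCategory.Q) := fun K L φ hφ => by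
    have := hF φ hφ
    exact inferInstanceAs (IsIso (DerivedCategory.Q.map (F.map φ)))
  have hG' : WB.IsInvertedBy (G ⋙ DerivedCategory.Q) := fun K L φ hφ => by
    have := hG φ hφ
    exact inferInstanceAs (IsIso (DerivedCategory.Q.map (G.map φ)))
  let F' : DerivedCategory A ⥤ DerivedCategory B := Localization.lift _ hF' DerivedCategory.Q
  let G' : DerivedCategory B ⥤ DerivedCategory A := Localization.lift _ hG' DerivedCategory.Q
  let iF : DerivedCategory.Q ⋙ F' ≅ F ⋙ DerivedCategory.Q := Localization.fac _ hF' _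
  let iG : DerivedCategory.Q ⋙ G' ≅ G ⋙ DerivedCategory.Q := Localization.fac _ hG' _
  let : Localization.Lifting DerivedCategory.Q WA (F ⋙ DerivedCategory.Q) F' := ⟨iF⟩
  -- The shift structure is the one induced by `F ⋙ Q`, so that `iF` is compatible with shifts and
  -- can transport triangles.
  let : F'.CommShift ℤ :=
    Functor.commShiftOfLocalization DerivedCategory.Q WA ℤ (F ⋙ DerivedCategory.Q) F'
  have : NatTrans.CommShift iF.hom ℤ :=
    NatTrans.commShift_iso_hom_of_localization DerivedCategory.Q WA ℤ (F ⋙ DerivedCategory.Q) F'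
  -- Every distinguished triangle is isomorphic to the image of a mapping cone triangle, so `e`
  -- suffices.
  have hF'T : F'.IsTriangulated := ⟨fun T hT => by
    rw [DerivedCategory.mem_distTriang_iff] at hT ⊢
    obtain ⟨K, L, φ, ⟨i⟩⟩ := hT
    exact ⟨_, _, F.map φ, ⟨F'.mapTriangle.mapIso i ≪≫
      (Functor.mapTriangleCompIso DerivedCategory.Q F').symm.app _ ≪≫
      (Functor.mapTriangleIso iF).app _ ≪≫
      (Functor.mapTriangleCompIso F DerivedCategory.Q).app _ ≪≫
      DerivedCategory.Q.mapTriangle.mapIso (e φ)⟩⟩⟩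
  have i₁ : F' ⋙ G' ≅ shiftFunctor (DerivedCategory A) (1 : ℤ) :=
    Localization.liftNatIso DerivedCategory.Q WA (DerivedCategory.Q ⋙ F' ⋙ G')
      (DerivedCategory.Q ⋙ shiftFunctor (DerivedCategory A) (1 : ℤ)) _ _
      ((Functor.associator _ _ _).symm ≪≫ Functor.isoWhiskerRight iF G' ≪≫
        Functor.associator _ _ _ ≪≫ Functor.isoWhiskerLeft F iG ≪≫
        (Functor.associator _ _ _).symm ≪≫ e₁ ≪≫ DerivedCategory.Q.commShiftIso (1 : ℤ))
  have i₂ : G' ⋙ F' ≅ shiftFunctor (DerivedCategory B) (1 : ℤ) :=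
    Localization.liftNatIso DerivedCategory.Q WB (DerivedCategory.Q ⋙ G' ⋙ F')
      (DerivedCategory.Q ⋙ shiftFunctor (DerivedCategory B) (1 : ℤ)) _ _
      ((Functor.associator _ _ _).symm ≪≫ Functor.isoWhiskerRight iG F' ≪≫
        Functor.associator _ _ _ ≪≫ Functor.isoWhiskerLeft G iF ≪≫
        (Functor.associator _ _ _).symm ≪≫ e₂ ≪≫ DerivedCategory.Q.commShiftIso (1 : ℤ))
  have : F'.IsEquivalence := Functor.isEquivalence_of_comp_iso F' G' i₁ i₂
  exact triangulatedEquivalent_of_isEquivalence F'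

end CategoryTheory

/-! ### Short exact sequences from commutative squares, and criteria for quasi-isomorphisms -/

open Limits Category Preadditive Pretriangulated

namespace CategoryTheory.CommSq

variable {C D : Type*} [Category C] [Category D] [Preadditive C] [Preadditive D]

/-- The short complex attached to a commutative square commutes with additive functors. -/
noncomputable def mapShortComplexIso [HasBinaryBiproducts C] [HasBinaryBiproducts D]
    {X₁ X₂ X₃ X₄ : C} {f : X₁ ⟶ X₂} {g : X₁ ⟶ X₃} {inl : X₂ ⟶ X₄} {inr : X₃ ⟶ X₄}
    (sq : CommSq f g inl inr) (F : C ⥤ D) [F.Additive] :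
    sq.shortComplex.map F ≅ (sq.map F).shortComplex :=
  let e : F.obj (X₂ ⊞ X₃) ≅ F.obj X₂ ⊞ F.obj X₃ :=
    { hom := biprod.lift (F.map biprod.fst) (F.map biprod.snd)
      inv := biprod.desc (F.map biprod.inl) (F.map biprod.inr)
      hom_inv_id := by
        rw [biprod.lift_desc, ← F.map_comp, ← F.map_comp, ← F.map_add, biprod.total, F.map_id]
      inv_hom_id := by
        apply biprod.hom_ext' <;> apply biprod.hom_ext <;> simp [← F.map_comp] }
  have h₁ : biprod.lift (F.map f) (-F.map g) = F.map (biprod.lift f (-g)) ≫ e.hom := by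
    apply biprod.hom_ext <;> simp [e, ← F.map_comp]
  have h₂ : e.hom ≫ biprod.desc (F.map inl) (F.map inr) = F.map (biprod.desc inl inr) := by
    rw [← Iso.eq_inv_comp]
    apply biprod.hom_ext' <;> simp [e, ← F.map_comp]
  ShortComplex.isoMk (Iso.refl _) e (Iso.refl _)
    ((id_comp _).trans h₁) (h₂.trans (comp_id _).symm)

variable [HasBinaryBiproducts C] {X₁ X₂ X₃ X₄ : C} {f : X₁ ⟶ X₂} {g : X₁ ⟶ X₃} {inl : X₂ ⟶ X₄}
    {inr : X₃ ⟶ X₄}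

/-- The complex `X₁ ⟶ X₂ ⊞ X₃ ⟶ X₄` splits: `inv f` on `X₂` is a retraction, and `inv inr` into `X₃`
is a section. -/
lemma shortExact_shortComplex_of_isIso [HasZeroObject C] (sq : CommSq f g inl inr) [IsIso f]
    [IsIso inr] : sq.shortComplex.ShortExact := by
  have h : inl ≫ inv inr = inv f ≫ g := by
    rw [IsIso.comp_inv_eq, assoc, ← sq.w, IsIso.inv_hom_id_assoc]
  have h₁ : biprod.lift f (-g) ≫ biprod.fst ≫ inv f = 𝟙 _ := by simp
  have h₂ : (inv inr ≫ biprod.inr) ≫ biprod.desc inl inr = 𝟙 _ := by simp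
  have h₃ : (biprod.fst ≫ inv f) ≫ biprod.lift f (-g) +
      biprod.desc inl inr ≫ inv inr ≫ biprod.inr = 𝟙 _ := by
    apply biprod.hom_ext' <;> apply biprod.hom_ext <;> simp [reassoc_of% h]
  exact ShortComplex.Splitting.shortExact ⟨_, _, h₁, h₂, h₃⟩

lemma shortExact_shortComplex_of_isIso' [HasZeroObject C] (sq : CommSq f g inl inr) [IsIso g]
    [IsIso inl] : sq.shortComplex.ShortExact := by
  have h : inr ≫ inv inl = inv g ≫ f := by
    rw [IsIso.comp_inv_eq, assoc, sq.w, IsIso.inv_hom_id_assoc]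
  -- The retraction carries a sign because the second component of the first map is `-g`.
  have h₁ : biprod.lift f (-g) ≫ (-biprod.snd ≫ inv g) = 𝟙 _ := by simp
  have h₂ : (inv inl ≫ biprod.inl) ≫ biprod.desc inl inr = 𝟙 _ := by simp
  have h₃ : (-biprod.snd ≫ inv g) ≫ biprod.lift f (-g) +
      biprod.desc inl inr ≫ inv inl ≫ biprod.inl = 𝟙 _ := by
    apply biprod.hom_ext' <;> apply biprod.hom_ext <;> simp [reassoc_of% h]
  exact ShortComplex.Splitting.shortExact ⟨_, _, h₁, h₂, h₃⟩

end CategoryTheory.CommSq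

namespace CochainComplex

variable {C : Type*} [Category C] [Abelian C] {X₁ X₂ X₃ X₄ E : CochainComplex C ℤ}
  {f : X₁ ⟶ X₂} {g : X₁ ⟶ X₃} {inl : X₂ ⟶ X₄} {inr : X₃ ⟶ X₄}

/-- A criterion for a morphism to a shift `X₄⟦1⟧` to be a quasi-isomorphism, when `X₄` is part
of a bicartesian square: the source of the morphism decomposes in each degree as a biproduct
given by the other three vertices of the square. -/
lemma quasiIso_of_shortExact_toShift (sq : CommSq f g inl inr) (hS : sq.shortComplex.ShortExact)
    (τ : E ⟶ X₄⟦(1 : ℤ)⟧)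
    (j₁ : ∀ i j : ℤ, j + 1 + 1 = i → (X₁.X i ⟶ E.X j))
    (j₂ : ∀ i j : ℤ, j + 1 = i → (X₂.X i ⟶ E.X j))
    (j₃ : ∀ i j : ℤ, j + 1 = i → (X₃.X i ⟶ E.X j))
    (hj₁ : ∀ j i k l (h : j + 1 = i) (h' : i + 1 = k) (h'' : k + 1 = l),
      j₁ k j (by lia) ≫ E.d j i =
        X₁.d k l ≫ j₁ l i (by lia) - f.f k ≫ j₂ k i h' + g.f k ≫ j₃ k i h')
    (hj₂ : ∀ j i k (h : j + 1 = i) (h' : i + 1 = k),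
      j₂ i j h ≫ E.d j i = -X₂.d i k ≫ j₂ k i h')
    (hj₃ : ∀ j i k (h : j + 1 = i) (h' : i + 1 = k),
      j₃ i j h ≫ E.d j i = -X₃.d i k ≫ j₃ k i h')
    (h₁ : ∀ i j h, j₁ i j h ≫ τ.f j = 0)
    (h₂ : ∀ i j h, j₂ i j h ≫ τ.f j ≫ (X₄.shiftXIso 1 j i h).hom = inl.f i)
    (h₃ : ∀ i j h, j₃ i j h ≫ τ.f j ≫ (X₄.shiftXIso 1 j i h).hom = inr.f i)
    (hj : ∀ j, IsIso (biprod.desc (j₁ _ j rfl) (biprod.desc (j₂ _ j rfl) (j₃ _ j rfl)))) :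
    QuasiIso τ := by
  let φ : X₁ ⟶ X₂ ⊞ X₃ := sq.shortComplex.f
  -- Short exactness makes `ψ` a quasi-isomorphism; it remains to identify `τ` with `ψ⟦1⟧` through
  -- an isomorphism `mappingCone φ⟦1⟧ ≅ E`.
  let ψ : mappingCone φ ⟶ X₄ := mappingCone.descShortComplex sq.shortComplex
  have hφ₁ (i : ℤ) : φ.f i ≫ (biprod.fst : X₂ ⊞ X₃ ⟶ _).f i = f.f i := by
    rw [← HomologicalComplex.comp_f]
    exact congr_arg (fun a => HomologicalComplex.Hom.f a i) (biprod.lift_fst f (-g))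
  have hφ₂ (i : ℤ) : φ.f i ≫ (biprod.snd : X₂ ⊞ X₃ ⟶ _).f i = -g.f i := by
    rw [← HomologicalComplex.comp_f]
    exact congr_arg (fun a => HomologicalComplex.Hom.f a i) (biprod.lift_snd f (-g))
  -- The isomorphism in each degree, assembled from the three inclusions; `j` is one less than `i`
  -- because of the shift.
  let σX (i : ℤ) (j : ℤ) (h : j + 1 = i) : (mappingCone φ).X i ⟶ E.X j :=
    (mappingCone.fst φ).1.v i (i + 1) rfl ≫ j₁ (i + 1) j (by lia) +
      (mappingCone.snd φ).v i i (add_zero i) ≫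
        ((biprod.fst : X₂ ⊞ X₃ ⟶ _).f i ≫ j₂ i j h + (biprod.snd : X₂ ⊞ X₃ ⟶ _).f i ≫ j₃ i j h)
  have hσ₁ (i j k : ℤ) (h : j + 1 = i) (h' : i + 1 = k) :
      (mappingCone.inl φ).v k i (by lia) ≫ σX i j h = j₁ k j (by lia) := by
    subst h'
    simp [σX]
  have hσ₂ (i j : ℤ) (h : j + 1 = i) : (mappingCone.inr φ).f i ≫ σX i j h =
      (biprod.fst : X₂ ⊞ X₃ ⟶ _).f i ≫ j₂ i j h + (biprod.snd : X₂ ⊞ X₃ ⟶ _).f i ≫ j₃ i j h := by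
    simp [σX]
  have hσd (i j k : ℤ) (h : j + 1 = i) (h' : i + 1 = k) :
      σX i j h ≫ E.d j i = -(mappingCone φ).d i k ≫ σX k i h' := by
    refine mappingCone.ext_from _ k i h' ?_ ?_
    · rw [reassoc_of% (hσ₁ i j k h h'), comp_neg,
        reassoc_of% (mappingCone.inl_v_d φ k i (k + 1) (by lia) (by lia)), sub_comp, assoc, assoc,
        hσ₁ k i (k + 1) h' rfl, hσ₂, hj₁ j i k (k + 1) h h' rfl, comp_add,
        reassoc_of% (hφ₁ k), reassoc_of% (hφ₂ k), neg_comp]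
      abel
    · rw [← assoc, hσ₂ i j h, comp_neg, mappingCone.inr_f_d_assoc, hσ₂]
      simp only [add_comp, comp_add, assoc, hj₂ j i k h h', hj₃ j i k h h',
        HomologicalComplex.Hom.comm_assoc, comp_neg]
      abel
  let σ : (mappingCone φ)⟦(1 : ℤ)⟧ ⟶ E :=
    { f := fun j => ((mappingCone φ).shiftXIso 1 j (j + 1) rfl).hom ≫ σX (j + 1) j rfl
      comm' := by
        rintro j _ rfl
        rw [reassoc_of% (shift_d_comp_shiftXIso_hom (mappingCone φ) 1 j (j + 1) _ _ rfl rfl),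
          assoc, hσd (j + 1) j _ rfl rfl, Int.negOnePow_one, Units.neg_smul, one_smul, comp_neg,
          neg_comp, assoc] }
  have hσ : ∀ j, IsIso (σ.f j) := fun j => by
    let e : (mappingCone φ).X (j + 1) ≅ X₁.X (j + 1 + 1) ⊞ (X₂.X (j + 1) ⊞ X₃.X (j + 1)) :=
      { hom := biprod.lift ((mappingCone.fst φ).1.v _ _ rfl)
          ((mappingCone.snd φ).v _ _ (add_zero _) ≫
            biprod.lift ((biprod.fst : X₂ ⊞ X₃ ⟶ _).f _) ((biprod.snd : X₂ ⊞ X₃ ⟶ _).f _))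
        inv := biprod.desc ((mappingCone.inl φ).v _ _ (by lia))
          (biprod.desc ((biprod.inl : _ ⟶ X₂ ⊞ X₃).f _) ((biprod.inr : _ ⟶ X₂ ⊞ X₃).f _) ≫
            (mappingCone.inr φ).f _)
        hom_inv_id := by
          refine mappingCone.ext_from _ _ _ rfl ?_ ?_
          · simp
          · simp
        inv_hom_id := by
          apply biprod.hom_ext'
          · simp
            apply biprod.hom_ext <;> simp
          · rw [biprod.inr_desc_assoc, comp_id]
            apply biprod.hom_ext'
            · simp only [biprod.inl_desc_assoc, assoc]
              apply biprod.hom_ext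
              · simp
              · apply biprod.hom_ext <;> simp
            · simp only [biprod.inr_desc_assoc, assoc]
              apply biprod.hom_ext
              · simp
              · apply biprod.hom_ext <;> simp }
    have : σ.f j = ((mappingCone φ).shiftXIso 1 j (j + 1) rfl).hom ≫ e.hom ≫
        biprod.desc (j₁ _ j rfl) (biprod.desc (j₂ _ j rfl) (j₃ _ j rfl)) := by
      dsimp only [σ, σX, e]
      simp
    rw [this]
    exact @IsIso.comp_isIso _ _ _ _ _ _ _ (Iso.isIso_hom _)
      (@IsIso.comp_isIso _ _ _ _ _ _ _ (Iso.isIso_hom _) (hj j))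
  have : IsIso σ := HomologicalComplex.Hom.isIso_of_components σ
  -- With `σ` an isomorphism and `ψ⟦1⟧` a quasi-isomorphism, `τ` is a quasi-isomorphism by two out
  -- of three.
  have fac : σ ≫ τ = ψ⟦(1 : ℤ)⟧' := by
    ext j
    rw [← cancel_mono (X₄.shiftXIso 1 j (j + 1) rfl).hom, shift_map_f_comp_shiftXIso_hom,
      HomologicalComplex.comp_f]
    dsimp only [σ]
    rw [assoc, assoc]
    congr 1
    refine mappingCone.ext_from _ _ _ rfl ?_ ?_
    · rw [reassoc_of% (hσ₁ (j + 1) j _ rfl rfl), reassoc_of% (h₁ _ j rfl), zero_comp]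
      exact (mappingCone.inl_v_descShortComplex_f sq.shortComplex _ _ _).symm
    · rw [reassoc_of% (hσ₂ (j + 1) j rfl), add_comp, assoc, assoc, h₂, h₃]
      refine Eq.trans ?_ (mappingCone.inr_f_descShortComplex_f sq.shortComplex _).symm
      rw [← HomologicalComplex.comp_f, ← HomologicalComplex.comp_f,
        ← HomologicalComplex.add_f_apply]
      congr 1
      apply biprod.hom_ext' <;> simp
  have : QuasiIso ψ := mappingCone.quasiIso_descShortComplex hS
  have : QuasiIso (σ ≫ τ) := by
    rw [fac]
    infer_instance
  exact quasiIso_of_comp_left σ τ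

/-- Here `E` is isomorphic to the cone of `γ : X₂ ⊞ X₃ ⟶ X₄`. Rotation identifies `X₁⟦1⟧` up to
homotopy with the cone of `X₂ ⊞ X₃ ⟶ mappingCone φ`, and the quasi-isomorphism `ψ : mappingCone φ ⟶
X₄` compares that cone with the cone of `γ`. The composite is `κ`. -/
lemma quasiIso_of_shortExact_ofShift (sq : CommSq f g inl inr) (hS : sq.shortComplex.ShortExact)
    (κ : X₁⟦(1 : ℤ)⟧ ⟶ E)
    (j₂ : ∀ i j : ℤ, j + 1 = i → (X₂.X i ⟶ E.X j))
    (j₃ : ∀ i j : ℤ, j + 1 = i → (X₃.X i ⟶ E.X j))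
    (j₄ : ∀ i : ℤ, X₄.X i ⟶ E.X i)
    (hj₂ : ∀ j i k (h : j + 1 = i) (h' : i + 1 = k),
      j₂ i j h ≫ E.d j i = inl.f i ≫ j₄ i - X₂.d i k ≫ j₂ k i h')
    (hj₃ : ∀ j i k (h : j + 1 = i) (h' : i + 1 = k),
      j₃ i j h ≫ E.d j i = inr.f i ≫ j₄ i - X₃.d i k ≫ j₃ k i h')
    (hj₄ : ∀ j i, j₄ j ≫ E.d j i = X₄.d j i ≫ j₄ i)
    (hκ : ∀ i j h, κ.f j = (X₁.shiftXIso 1 j i h).hom ≫ (f.f i ≫ j₂ i j h - g.f i ≫ j₃ i j h))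
    (hj : ∀ j, IsIso (biprod.desc (biprod.desc (j₂ _ j rfl) (j₃ _ j rfl)) (j₄ j))) :
    QuasiIso κ := by
  let φ : X₁ ⟶ X₂ ⊞ X₃ := sq.shortComplex.f
  let γ : X₂ ⊞ X₃ ⟶ X₄ := sq.shortComplex.g
  let ψ : mappingCone φ ⟶ X₄ := mappingCone.descShortComplex sq.shortComplex
  have hψ : mappingCone.inr φ ≫ ψ = 𝟙 _ ≫ γ :=
    (mappingCone.inr_descShortComplex sq.shortComplex).trans (id_comp _).symm
  have hφ₁ (i : ℤ) : φ.f i ≫ (biprod.fst : X₂ ⊞ X₃ ⟶ _).f i = f.f i := by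
    rw [← HomologicalComplex.comp_f]
    exact congr_arg (fun a => HomologicalComplex.Hom.f a i) (biprod.lift_fst f (-g))
  have hφ₂ (i : ℤ) : φ.f i ≫ (biprod.snd : X₂ ⊞ X₃ ⟶ _).f i = -g.f i := by
    rw [← HomologicalComplex.comp_f]
    exact congr_arg (fun a => HomologicalComplex.Hom.f a i) (biprod.lift_snd f (-g))
  have hγ (i : ℤ) : γ.f i = (biprod.fst : X₂ ⊞ X₃ ⟶ _).f i ≫ inl.f i +
      (biprod.snd : X₂ ⊞ X₃ ⟶ _).f i ≫ inr.f i := by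
    rw [← HomologicalComplex.comp_f, ← HomologicalComplex.comp_f,
      ← HomologicalComplex.add_f_apply]
    refine congr_arg (fun a => HomologicalComplex.Hom.f a i) ?_
    exact (biprod.hom_ext' _ _ (by simp) (by simp) :
      biprod.desc inl inr = biprod.fst ≫ inl + biprod.snd ≫ inr)
  let σX (i j : ℤ) (h : j + 1 = i) : (mappingCone γ).X j ⟶ E.X j :=
    (mappingCone.fst γ).1.v j i h ≫
        ((biprod.fst : X₂ ⊞ X₃ ⟶ _).f i ≫ j₂ i j h + (biprod.snd : X₂ ⊞ X₃ ⟶ _).f i ≫ j₃ i j h) +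
      (mappingCone.snd γ).v j j (add_zero j) ≫ j₄ j
  have hσ₁ (i j : ℤ) (h : j + 1 = i) : (mappingCone.inl γ).v i j (by lia) ≫ σX i j h =
      (biprod.fst : X₂ ⊞ X₃ ⟶ _).f i ≫ j₂ i j h + (biprod.snd : X₂ ⊞ X₃ ⟶ _).f i ≫ j₃ i j h := by
    simp [σX]
  have hσ₂ (i j : ℤ) (h : j + 1 = i) : (mappingCone.inr γ).f j ≫ σX i j h = j₄ j := by
    simp [σX]
  let σ : mappingCone γ ⟶ E :=
    { f := fun j => σX (j + 1) j rfl
      comm' := by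
        rintro j _ rfl
        refine mappingCone.ext_from _ _ _ rfl ?_ ?_
        · rw [reassoc_of% (hσ₁ (j + 1) j rfl),
            reassoc_of% (mappingCone.inl_v_d γ (j + 1) j (j + 1 + 1) (by lia) (by lia)), sub_comp,
            assoc, assoc, hσ₁, hσ₂, hγ]
          simp only [add_comp, comp_add, assoc, hj₂ j _ _ rfl rfl, hj₃ j _ _ rfl rfl,
            HomologicalComplex.Hom.comm_assoc, comp_sub]
          abel
        · rw [reassoc_of% (hσ₂ (j + 1) j rfl), mappingCone.inr_f_d_assoc, hσ₂, hj₄] }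
  have hσ : ∀ j, IsIso (σ.f j) := fun j => by
    let e : (mappingCone γ).X j ≅ (X₂.X (j + 1) ⊞ X₃.X (j + 1)) ⊞ X₄.X j :=
      { hom := biprod.lift ((mappingCone.fst γ).1.v _ _ rfl ≫
            biprod.lift ((biprod.fst : X₂ ⊞ X₃ ⟶ _).f _) ((biprod.snd : X₂ ⊞ X₃ ⟶ _).f _))
          ((mappingCone.snd γ).v _ _ (add_zero _))
        inv := biprod.desc
          (biprod.desc ((biprod.inl : _ ⟶ X₂ ⊞ X₃).f _) ((biprod.inr : _ ⟶ X₂ ⊞ X₃).f _) ≫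
            (mappingCone.inl γ).v _ _ (by lia))
          ((mappingCone.inr γ).f _)
        hom_inv_id := by
          refine mappingCone.ext_from _ _ _ rfl ?_ ?_
          · simp
          · simp
        inv_hom_id := by
          apply biprod.hom_ext'
          · rw [biprod.inl_desc_assoc, comp_id]
            apply biprod.hom_ext'
            · simp only [biprod.inl_desc_assoc, assoc]
              apply biprod.hom_ext
              · apply biprod.hom_ext <;> simp
              · simp
            · simp only [biprod.inr_desc_assoc, assoc]
              apply biprod.hom_ext
              · apply biprod.hom_ext <;> simp
              · simp
          · simp
            apply biprod.hom_ext <;> simp }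
    have : σ.f j = e.hom ≫ biprod.desc (biprod.desc (j₂ _ j rfl) (j₃ _ j rfl)) (j₄ j) := by
      dsimp only [σ, σX, e]
      simp
    rw [this]
    exact @IsIso.comp_isIso _ _ _ _ _ _ _ (Iso.isIso_hom _) (hj j)
  have : IsIso σ := HomologicalComplex.Hom.isIso_of_components σ
  let μ := mappingCone.map (mappingCone.inr φ) γ (𝟙 _) ψ hψ
  have : QuasiIso ψ := mappingCone.quasiIso_descShortComplex hS
  have : QuasiIso μ := mappingCone.quasiIso_map _ _ _ _ _
  have : QuasiIso (mappingCone.rotateHomotopyEquiv φ).hom := inferInstance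
  have fac : (mappingCone.rotateHomotopyEquiv φ).hom ≫ μ ≫ σ = κ := by
    ext j
    have hμ : μ.f j ≫ σ.f j = (mappingCone.fst (mappingCone.inr φ)).1.v j (j + 1) rfl ≫
        ((biprod.fst : X₂ ⊞ X₃ ⟶ _).f _ ≫ j₂ _ j rfl +
          (biprod.snd : X₂ ⊞ X₃ ⟶ _).f _ ≫ j₃ _ j rfl) +
        (mappingCone.snd (mappingCone.inr φ)).v j j (add_zero j) ≫ ψ.f j ≫ j₄ j := by
      refine mappingCone.ext_from _ _ _ rfl ?_ ?_
      · rw [reassoc_of% (mappingCone.inl_v_map_f _ _ _ _ hψ (j + 1) j (by lia)),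
          HomologicalComplex.id_f, id_comp]
        refine (hσ₁ (j + 1) j rfl).trans ?_
        simp
      · rw [reassoc_of% (mappingCone.inr_f_map_f _ _ _ _ hψ j)]
        refine (congr_arg (fun a => ψ.f j ≫ a) (hσ₂ (j + 1) j rfl)).trans ?_
        simp
    have r₁ : (mappingCone.rotateHomotopyEquiv φ).hom.f j ≫
        (mappingCone.fst (mappingCone.inr φ)).1.v j (j + 1) rfl =
        (X₁.shiftXIso 1 j (j + 1) rfl).hom ≫ φ.f (j + 1) := by
      refine (mappingCone.lift_f_fst_v _ _ _ _ j (j + 1) rfl).trans ?_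
      -- The sign of the left shift cancels the minus sign in the rotation equivalence.
      change (-(HomComplex.Cochain.ofHom φ).leftShift 1 1 (zero_add 1)).v j (j + 1) rfl = _
      rw [HomComplex.Cochain.neg_v,
        HomComplex.Cochain.leftShift_v _ 1 1 (zero_add 1) j (j + 1) rfl (j + 1) (by lia)]
      simp
      exact neg_neg _
    have r₂ : (mappingCone.rotateHomotopyEquiv φ).hom.f j ≫
        (mappingCone.snd (mappingCone.inr φ)).v j j (add_zero j) ≫ ψ.f j = 0 := by
      have h : (mappingCone.rotateHomotopyEquiv φ).hom.f j ≫
          (mappingCone.snd (mappingCone.inr φ)).v j j (add_zero j) =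
          -(X₁.shiftXIso 1 j (j + 1) rfl).hom ≫ (mappingCone.inl φ).v (j + 1) j (by lia) := by
        refine (mappingCone.lift_f_snd_v _ _ _ _ j j (add_zero j)).trans ?_
        rw [HomComplex.Cochain.neg_v, HomComplex.Cochain.leftShift_v _ 1 0
          (neg_add_cancel 1) j j (add_zero j) (j + 1) (by lia)]
        simp
        rfl
      rw [reassoc_of% h, neg_comp, assoc]
      -- The second component of the rotation lands in the summand `X₁` of the cone, which `ψ`
      -- kills.
      refine neg_eq_zero.2 ((congr_arg _ ?_).trans comp_zero)
      exact mappingCone.inl_v_descShortComplex_f sq.shortComplex _ _ _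
    rw [HomologicalComplex.comp_f, HomologicalComplex.comp_f, hμ, comp_add, reassoc_of% r₁,
      reassoc_of% r₂, zero_comp, add_zero, hκ _ _ rfl, comp_add, reassoc_of% (hφ₁ (j + 1)),
      reassoc_of% (hφ₂ (j + 1)), sub_eq_add_neg, neg_comp]
  rw [← fac]
  infer_instance

end CochainComplex

/-! ### Composites of two cone functors compared with the shift -/

open Limits Category Preadditive Pretriangulated

namespace CategoryTheory.NatTrans.coneFunctor

section

variable {A B D : Type*} [Category A] [Category B] [Category D] [Preadditive A] [Preadditive B]
  [HasBinaryBiproducts B] {U V : A ⥤ B} [U.Additive] [V.Additive] (α : U ⟶ V)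
  (K : CochainComplex A ℤ) (W : B ⥤ D) (i j : ℤ)

@[simp]
lemma map_inlX_map_fstX (h : j + 1 = i) :
    W.map (inlX α K i j h) ≫ W.map (fstX α K j i h) = 𝟙 _ := by
  rw [← W.map_comp, inlX_fstX, W.map_id]

@[simp]
lemma map_inlX_map_fstX_assoc (h : j + 1 = i) {Z : D} (f : _ ⟶ Z) :
    W.map (inlX α K i j h) ≫ W.map (fstX α K j i h) ≫ f = f := by
  rw [← W.map_comp_assoc, inlX_fstX, W.map_id, id_comp]

@[simp]
lemma map_inrX_map_sndX : W.map (inrX α K i) ≫ W.map (sndX α K i) = 𝟙 _ := by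
  rw [← W.map_comp, inrX_sndX, W.map_id]

@[simp]
lemma map_inrX_map_sndX_assoc {Z : D} (f : _ ⟶ Z) :
    W.map (inrX α K i) ≫ W.map (sndX α K i) ≫ f = f := by
  rw [← W.map_comp_assoc, inrX_sndX, W.map_id, id_comp]

variable [Preadditive D] [W.Additive]

@[simp]
lemma map_inlX_map_sndX (h : j + 1 = i) :
    W.map (inlX α K i j h) ≫ W.map (sndX α K j) = 0 := by
  rw [← W.map_comp, inlX_sndX, W.map_zero]

@[simp]
lemma map_inlX_map_sndX_assoc (h : j + 1 = i) {Z : D} (f : _ ⟶ Z) :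
    W.map (inlX α K i j h) ≫ W.map (sndX α K j) ≫ f = 0 := by
  rw [← W.map_comp_assoc, inlX_sndX, W.map_zero, zero_comp]

@[simp]
lemma map_inrX_map_fstX (h : i + 1 = j) :
    W.map (inrX α K i) ≫ W.map (fstX α K i j h) = 0 := by
  rw [← W.map_comp, inrX_fstX, W.map_zero]

@[simp]
lemma map_inrX_map_fstX_assoc (h : i + 1 = j) {Z : D} (f : _ ⟶ Z) :
    W.map (inrX α K i) ≫ W.map (fstX α K i j h) ≫ f = 0 := by
  rw [← W.map_comp_assoc, inrX_fstX, W.map_zero, zero_comp]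

variable {K W i j} in
lemma map_hom_ext (h : j + 1 = i) {Z : D} {f g : W.obj ((α.coneFunctor.obj K).X j) ⟶ Z}
    (h₁ : W.map (inlX α K i j h) ≫ f = W.map (inlX α K i j h) ≫ g)
    (h₂ : W.map (inrX α K j) ≫ f = W.map (inrX α K j) ≫ g) : f = g := by
  have H := congr_arg W.map (id_eq α K i j h)
  rw [W.map_id, W.map_add, W.map_comp, W.map_comp] at H
  rw [← id_comp f, ← id_comp g, ← H, add_comp, add_comp, assoc, assoc, assoc, assoc, h₁, h₂]

end

variable {A B : Type*} [Category A] [Category B] [Preadditive A] [Preadditive B]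
  [HasBinaryBiproducts A] [HasBinaryBiproducts B]
  {U V : A ⥤ B} [U.Additive] [V.Additive] (α : U ⟶ V)
  {U' V' : B ⥤ A} [U'.Additive] [V'.Additive] (β : V' ⟶ U')

/-- A term of the double cone is the sum of `U V'`, `U U'`, `V V'` and `V U'`, in source degrees `j
+ 2`, `j + 1`, `j + 1` and `j`. -/
lemma comp_hom_ext {L : CochainComplex B ℤ} {i j k : ℤ} (h : j + 1 = i) (h' : i + 1 = k) {Z : B}
    {f g : (α.coneFunctor.obj (β.coneFunctor.obj L)).X j ⟶ Z}
    (h₁ : U.map (inlX β L k i h') ≫ inlX α _ i j h ≫ f =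
      U.map (inlX β L k i h') ≫ inlX α _ i j h ≫ g)
    (h₂ : U.map (inrX β L i) ≫ inlX α _ i j h ≫ f = U.map (inrX β L i) ≫ inlX α _ i j h ≫ g)
    (h₃ : V.map (inlX β L i j h) ≫ inrX α _ j ≫ f = V.map (inlX β L i j h) ≫ inrX α _ j ≫ g)
    (h₄ : V.map (inrX β L j) ≫ inrX α _ j ≫ f = V.map (inrX β L j) ≫ inrX α _ j ≫ g) :
    f = g :=
  hom_ext α h (map_hom_ext β h' h₁ h₂) (map_hom_ext β h h₃ h₄)

section ToShift

variable (ε : U' ⋙ U ⟶ 𝟭 B) (ν : V' ⋙ V ⟶ 𝟭 B)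
  (hVU' : ∀ Y, IsZero (V.obj (U'.obj Y)))
  (w : ∀ Y, U.map (β.app Y) ≫ ε.app Y = α.app (V'.obj Y) ≫ ν.app Y)

/-- The morphism `toShift`, in each degree. -/
noncomputable def toShiftX (L : CochainComplex B ℤ) (j i : ℤ) (h : j + 1 = i) :
    (α.coneFunctor.obj (β.coneFunctor.obj L)).X j ⟶ L.X i :=
  fstX α _ j i h ≫ U.map (sndX β L i) ≫ ε.app (L.X i) +
    sndX α _ j ≫ V.map (fstX β L j i h) ≫ ν.app (L.X i)

variable (L : CochainComplex B ℤ) (i j k : ℤ) (h : j + 1 = i) (h' : i + 1 = k)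

lemma map_inlX_inlX_toShiftX :
    U.map (inlX β L k i h') ≫ inlX α _ i j h ≫ toShiftX α β ε ν L j i h = 0 := by
  simp [toShiftX]

lemma map_inrX_inlX_toShiftX :
    U.map (inrX β L i) ≫ inlX α _ i j h ≫ toShiftX α β ε ν L j i h = ε.app (L.X i) := by
  simp [toShiftX]

lemma map_inlX_inrX_toShiftX :
    V.map (inlX β L i j h) ≫ inrX α _ j ≫ toShiftX α β ε ν L j i h = ν.app (L.X i) := by
  simp [toShiftX]

/-- On the doubly shifted summand `U V'` the two minus signs cancel on `d`, while `β` and `α` enter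
with opposite signs, as in the map `(f, -g)` attached to a square, up to a global sign. -/
lemma map_inlX_inlX_d (l : ℤ) (h'' : k + 1 = l) :
    U.map (inlX β L k i h') ≫ inlX α _ i j h ≫
        (α.coneFunctor.obj (β.coneFunctor.obj L)).d j i =
      U.map (V'.map (L.d k l)) ≫ U.map (inlX β L l k h'') ≫ inlX α _ k i h' -
      U.map (β.app (L.X k)) ≫ U.map (inrX β L k) ≫ inlX α _ k i h' +
      α.app (V'.obj (L.X k)) ≫ V.map (inlX β L k i h') ≫ inrX α _ i := by
  rw [inlX_d α _ i j k h h', comp_sub, reassoc_of% (α.naturality (inlX β L k i h')),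
    ← U.map_comp_assoc, inlX_d β L k i l h' h'', U.map_sub, sub_comp, U.map_comp, U.map_comp,
    assoc, assoc]
  abel

lemma map_inrX_inlX_d (hVU' : ∀ Y, IsZero (V.obj (U'.obj Y))) :
    U.map (inrX β L i) ≫ inlX α _ i j h ≫ (α.coneFunctor.obj (β.coneFunctor.obj L)).d j i =
      -U.map (U'.map (L.d i k)) ≫ U.map (inrX β L k) ≫ inlX α _ k i h' := by
  rw [inlX_d α _ i j k h h', comp_sub, reassoc_of% (α.naturality (inrX β L i)),
    ← U.map_comp_assoc, inrX_d β L i k, U.map_comp, assoc,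
    (hVU' (L.X i)).eq_of_src (V.map (inrX β L i) ≫ inrX α _ i) 0, comp_zero, zero_sub]

lemma map_inlX_inrX_d (hVU' : ∀ Y, IsZero (V.obj (U'.obj Y))) :
    V.map (inlX β L i j h) ≫ inrX α _ j ≫ (α.coneFunctor.obj (β.coneFunctor.obj L)).d j i =
      -V.map (V'.map (L.d i k)) ≫ V.map (inlX β L k i h') ≫ inrX α _ i := by
  rw [inrX_d α _ j i, ← V.map_comp_assoc, inlX_d β L i j k h h', V.map_sub, sub_comp, V.map_comp,
    V.map_comp, assoc, assoc, (hVU' (L.X i)).eq_of_src (V.map (inrX β L i) ≫ inrX α _ i) 0,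
    comp_zero, zero_sub]

include w hVU' in
-- On `U V'` the contributions through `U U'` and `V V'` cancel by commutativity of the square; on
-- those two summands the claim is naturality of `ε` and `ν`, and `V U'` vanishes. The minus sign is
-- that of the differential of `L⟦1⟧`.
lemma toShiftX_d : toShiftX α β ε ν L j i h ≫ L.d i k =
    -(α.coneFunctor.obj (β.coneFunctor.obj L)).d j i ≫ toShiftX α β ε ν L i k h' := by
  have hε := ε.naturality (L.d i k)
  have hν := ν.naturality (L.d i k)
  dsimp at hε hν
  apply comp_hom_ext α β h h'
  · rw [reassoc_of% (map_inlX_inlX_toShiftX α β ε ν L i j k h h'), comp_neg, comp_neg,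
      reassoc_of% (map_inlX_inlX_d α β L i j k h h' _ rfl)]
    simp only [add_comp, sub_comp, assoc, map_inlX_inlX_toShiftX, map_inrX_inlX_toShiftX,
      map_inlX_inrX_toShiftX, w]
    simp
  · rw [reassoc_of% (map_inrX_inlX_toShiftX α β ε ν L i j h), comp_neg, comp_neg,
      reassoc_of% (map_inrX_inlX_d α β L i j k h h' hVU'), neg_comp, assoc, assoc,
      map_inrX_inlX_toShiftX, neg_neg, hε]
  · rw [reassoc_of% (map_inlX_inrX_toShiftX α β ε ν L i j h), comp_neg, comp_neg,
      reassoc_of% (map_inlX_inrX_d α β L i j k h h' hVU'), neg_comp, assoc, assoc,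
      map_inlX_inrX_toShiftX, neg_neg, hν]
  · exact (hVU' (L.X j)).eq_of_src _ _

/-- The canonical natural transformation from the composition of two functors
`coneFunctor` to the shift functor. -/
noncomputable def toShift : β.coneFunctor ⋙ α.coneFunctor ⟶
    shiftFunctor (CochainComplex B ℤ) (1 : ℤ) where
  app L :=
    { f := fun j => toShiftX α β ε ν L j (j + 1) rfl ≫
        (CochainComplex.shiftXIso L 1 j (j + 1) rfl).inv
      comm' := by
        rintro j _ rfl
        rw [← cancel_mono (CochainComplex.shiftXIso L 1 (j + 1) (j + 1 + 1) rfl).hom, assoc, assoc,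
          CochainComplex.shift_d_comp_shiftXIso_hom L 1 j (j + 1) _ _ rfl rfl, assoc, assoc,
          Iso.inv_hom_id, comp_id, Int.negOnePow_one, Units.neg_smul, one_smul, comp_neg,
          Iso.inv_hom_id_assoc, comp_neg, toShiftX_d α β ε ν hVU' w L _ _ _ rfl rfl, neg_neg]
        rfl }
  naturality L L' φ := by
    ext j
    have hε := ε.naturality (φ.f (j + 1))
    have hν := ν.naturality (φ.f (j + 1))
    dsimp at hε hν
    dsimp only [Functor.comp_map, HomologicalComplex.comp_f]
    rw [← cancel_mono (CochainComplex.shiftXIso L' 1 j (j + 1) rfl).hom, assoc, assoc, assoc,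
      CochainComplex.shift_map_f_comp_shiftXIso_hom φ 1 j (j + 1) rfl, assoc,
      Iso.inv_hom_id, comp_id, Iso.inv_hom_id_assoc]
    dsimp only [toShiftX]
    simp only [comp_add, add_comp, assoc, map_f_fstX_assoc, map_f_sndX_assoc, ← U.map_comp_assoc,
      ← V.map_comp_assoc, map_f_fstX, map_f_sndX]
    simp only [U.map_comp, V.map_comp, assoc, hε, hν]

lemma toShift_app_f_shiftXIso_hom :
    ((toShift α β ε ν hVU' w).app L).f j ≫ (CochainComplex.shiftXIso L 1 j i h).hom =
      toShiftX α β ε ν L j i h := by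
  subst h
  refine (assoc _ _ _).trans ?_
  rw [Iso.inv_hom_id, comp_id]

end ToShift

section OfShift

variable (η : 𝟭 A ⟶ V ⋙ V') (θ : 𝟭 A ⟶ U ⋙ U')
  (w : ∀ X, η.app X ≫ β.app (V.obj X) = θ.app X ≫ U'.map (α.app X))

/-- The morphism `ofShift`, in each degree. -/
noncomputable def ofShiftX (K : CochainComplex A ℤ) (i j : ℤ) (h : j + 1 = i) :
    K.X i ⟶ (β.coneFunctor.obj (α.coneFunctor.obj K)).X j :=
  η.app (K.X i) ≫ V'.map (inrX α K i) ≫ inlX β _ i j h -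
    θ.app (K.X i) ≫ U'.map (inlX α K i j h) ≫ inrX β _ j

variable (K : CochainComplex A ℤ) (i j k : ℤ) (h : j + 1 = i) (h' : i + 1 = k)

lemma map_inrX_inlX_d' :
    V'.map (inrX α K i) ≫ inlX β _ i j h ≫ (β.coneFunctor.obj (α.coneFunctor.obj K)).d j i =
      β.app (V.obj (K.X i)) ≫ U'.map (inrX α K i) ≫ inrX β _ i -
      V'.map (V.map (K.d i k)) ≫ V'.map (inrX α K k) ≫ inlX β _ k i h' := by
  rw [inlX_d β _ i j k h h', comp_sub, reassoc_of% (β.naturality (inrX α K i)),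
    ← V'.map_comp_assoc, inrX_d α K i k, V'.map_comp, assoc]

lemma map_inlX_inrX_d' :
    U'.map (inlX α K i j h) ≫ inrX β _ j ≫ (β.coneFunctor.obj (α.coneFunctor.obj K)).d j i =
      U'.map (α.app (K.X i)) ≫ U'.map (inrX α K i) ≫ inrX β _ i -
      U'.map (U.map (K.d i k)) ≫ U'.map (inlX α K k i h') ≫ inrX β _ i := by
  rw [inrX_d β _ j i, ← U'.map_comp_assoc, inlX_d α K i j k h h', U'.map_sub, sub_comp,
    U'.map_comp, U'.map_comp, assoc, assoc]

lemma map_inrX_inrX_d :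
    U'.map (inrX α K j) ≫ inrX β _ j ≫ (β.coneFunctor.obj (α.coneFunctor.obj K)).d j i =
      U'.map (V.map (K.d j i)) ≫ U'.map (inrX α K i) ≫ inrX β _ i := by
  rw [inrX_d β _ j i, ← U'.map_comp_assoc, inrX_d α K j i, U'.map_comp, assoc]

include w in
-- `ofShiftX` is a difference, so its two contributions to the summand `U'V` cancel by commutativity
-- of the square; the rest is naturality of `η` and `θ`.
lemma ofShiftX_d : ofShiftX α β η θ K i j h ≫ (β.coneFunctor.obj (α.coneFunctor.obj K)).d j i =
    -K.d i k ≫ ofShiftX α β η θ K k i h' := by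
  have hη := η.naturality (K.d i k)
  have hθ := θ.naturality (K.d i k)
  dsimp at hη hθ
  simp only [ofShiftX, sub_comp, comp_sub, assoc, map_inrX_inlX_d' α β K i j k h h',
    map_inlX_inrX_d' α β K i j k h h', reassoc_of% hη, reassoc_of% hθ, reassoc_of% (w (K.X i))]
  abel

lemma f_comp_ofShiftX {K K' : CochainComplex A ℤ} (φ : K ⟶ K') (i j : ℤ) (h : j + 1 = i) :
    φ.f i ≫ ofShiftX α β η θ K' i j h =
      ofShiftX α β η θ K i j h ≫ (β.coneFunctor.map (α.coneFunctor.map φ)).f j := by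
  have hη := η.naturality (φ.f i)
  have hθ := θ.naturality (φ.f i)
  dsimp at hη hθ
  simp only [ofShiftX, comp_sub, sub_comp, assoc, inlX_map_f, inrX_map_f, ← U'.map_comp_assoc,
    ← V'.map_comp_assoc]
  simp only [U'.map_comp, V'.map_comp, assoc, reassoc_of% hη, reassoc_of% hθ]

/-- The canonical natural transformation from the shift functor to
the composition of two functors `coneFunctor`. -/
noncomputable def ofShift : shiftFunctor (CochainComplex A ℤ) (1 : ℤ) ⟶
    α.coneFunctor ⋙ β.coneFunctor where
  app K :=
    { f := fun j => (CochainComplex.shiftXIso K 1 j (j + 1) rfl).hom ≫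
        ofShiftX α β η θ K (j + 1) j rfl
      comm' := by
        rintro j _ rfl
        rw [reassoc_of% (CochainComplex.shift_d_comp_shiftXIso_hom K 1 j (j + 1) _ _ rfl rfl),
          assoc, Int.negOnePow_one, Units.neg_smul, one_smul, neg_comp, assoc]
        refine (congr_arg _ (ofShiftX_d α β η θ w K _ _ _ rfl rfl)).trans ?_
        rw [comp_neg] }
  naturality K K' φ := by
    ext j
    dsimp only [Functor.comp_map, HomologicalComplex.comp_f]
    rw [reassoc_of% (CochainComplex.shift_map_f_comp_shiftXIso_hom φ 1 j (j + 1) rfl), assoc]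
    exact congr_arg _ (f_comp_ofShiftX α β η θ φ _ _ rfl)

lemma ofShift_app_f :
    ((ofShift α β η θ w).app K).f j = (CochainComplex.shiftXIso K 1 j i h).hom ≫
      ofShiftX α β η θ K i j h := by
  subst h
  rfl

end OfShift

end CategoryTheory.NatTrans.coneFunctor

namespace CochainComplex

variable {C : Type*} [Category C] [Abelian C] {X₁ X₂ X₃ X₄ : CochainComplex C ℤ}
  {f : X₁ ⟶ X₂} {g : X₁ ⟶ X₃} {inl : X₂ ⟶ X₄} {inr : X₃ ⟶ X₄}

lemma shortExact_shortComplex_of_degreewise (sq : CommSq f g inl inr)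
    (h : ∀ i, (sq.map (HomologicalComplex.eval C (ComplexShape.up ℤ) i)).shortComplex.ShortExact) :
    sq.shortComplex.ShortExact :=
  HomologicalComplex.shortExact_of_degreewise_shortExact _ fun i =>
    (ShortComplex.shortExact_iff_of_iso (sq.mapShortComplexIso _)).2 (h i)

end CochainComplex

namespace CategoryTheory.NatTrans.coneFunctor

variable {A B : Type*} [Category A] [Category B] [Abelian A] [Abelian B]
  {U V : A ⥤ B} [U.Additive] [V.Additive] (α : U ⟶ V)
  {U' V' : B ⥤ A} [U'.Additive] [V'.Additive] (β : V' ⟶ U')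

/-- As `V U' = 0`, the double cone has only the summands given by the first three vertices of the
square `U V' L, U U' L, V V' L, L`, which is what `quasiIso_of_shortExact_toShift` requires. -/
lemma quasiIso_toShift_app (ε : U' ⋙ U ⟶ 𝟭 B) (ν : V' ⋙ V ⟶ 𝟭 B)
    (hVU' : ∀ Y, IsZero (V.obj (U'.obj Y)))
    (w : ∀ Y, U.map (β.app Y) ≫ ε.app Y = α.app (V'.obj Y) ≫ ν.app Y)
    (hS : ∀ Y, (CommSq.mk (w Y)).shortComplex.ShortExact) (L : CochainComplex B ℤ) :
    QuasiIso ((toShift α β ε ν hVU' w).app L) := by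
  let X₁ : CochainComplex B ℤ :=
    (U.mapHomologicalComplex _).obj ((V'.mapHomologicalComplex _).obj L)
  let X₂ : CochainComplex B ℤ :=
    (U.mapHomologicalComplex _).obj ((U'.mapHomologicalComplex _).obj L)
  let X₃ : CochainComplex B ℤ :=
    (V.mapHomologicalComplex _).obj ((V'.mapHomologicalComplex _).obj L)
  let f : X₁ ⟶ X₂ := (U.mapHomologicalComplex _).map
    ((NatTrans.mapHomologicalComplex β (ComplexShape.up ℤ)).app L)
  let g : X₁ ⟶ X₃ := (NatTrans.mapHomologicalComplex α (ComplexShape.up ℤ)).app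
    ((V'.mapHomologicalComplex _).obj L)
  let inl : X₂ ⟶ L :=
    { f := fun i => ε.app (L.X i), comm' := fun i j _ => (ε.naturality (L.d i j)).symm }
  let inr : X₃ ⟶ L :=
    { f := fun i => ν.app (L.X i), comm' := fun i j _ => (ν.naturality (L.d i j)).symm }
  have sq : CommSq f g inl inr := ⟨by ext i; exact w (L.X i)⟩
  let j₁ (i j : ℤ) (h : j + 1 + 1 = i) :
      U.obj (V'.obj (L.X i)) ⟶ (α.coneFunctor.obj (β.coneFunctor.obj L)).X j :=
    U.map (inlX β L i (j + 1) h) ≫ inlX α _ (j + 1) j rfl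
  let j₂ (i j : ℤ) (h : j + 1 = i) :
      U.obj (U'.obj (L.X i)) ⟶ (α.coneFunctor.obj (β.coneFunctor.obj L)).X j :=
    U.map (inrX β L i) ≫ inlX α _ i j h
  let j₃ (i j : ℤ) (h : j + 1 = i) :
      V.obj (V'.obj (L.X i)) ⟶ (α.coneFunctor.obj (β.coneFunctor.obj L)).X j :=
    V.map (inlX β L i j h) ≫ inrX α _ j
  have hj (j : ℤ) :
      IsIso (biprod.desc (j₁ _ j rfl) (biprod.desc (j₂ _ j rfl) (j₃ _ j rfl))) := by
    -- The inverse is the tuple of projections; the summand `V U'` they miss is zero.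
    refine ⟨⟨biprod.lift (fstX α _ j (j + 1) rfl ≫ U.map (fstX β L _ _ rfl))
      (biprod.lift (fstX α _ j (j + 1) rfl ≫ U.map (sndX β L _))
        (sndX α _ j ≫ V.map (fstX β L _ _ rfl))), ?_, ?_⟩⟩
    · apply biprod.hom_ext'
      · apply biprod.hom_ext
        · simp [j₁]
        · apply biprod.hom_ext <;> simp [j₁]
      · apply biprod.hom_ext'
        · apply biprod.hom_ext
          · simp [j₂]
          · apply biprod.hom_ext <;> simp [j₂]
        · apply biprod.hom_ext
          · simp [j₃]
          · apply biprod.hom_ext <;> simp [j₃]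
    · apply comp_hom_ext α β rfl rfl
      · simp [j₁]
      · simp [j₂]
      · simp [j₃]
      · exact (hVU' _).eq_of_src _ _
  refine CochainComplex.quasiIso_of_shortExact_toShift sq
    (CochainComplex.shortExact_shortComplex_of_degreewise sq fun i => hS (L.X i)) _
    j₁ j₂ j₃ ?_ ?_ ?_ ?_ ?_ ?_ hj
  · rintro j _ _ _ rfl rfl rfl
    exact (assoc _ _ _).trans (map_inlX_inlX_d α β L (j + 1) j _ rfl rfl _ rfl)
  · rintro j _ _ rfl rfl
    exact (assoc _ _ _).trans (map_inrX_inlX_d α β L _ _ _ rfl rfl hVU')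
  · rintro j _ _ rfl rfl
    exact (assoc _ _ _).trans (map_inlX_inrX_d α β L _ _ _ rfl rfl hVU')
  · rintro _ j rfl
    have : j₁ _ j rfl ≫ ((toShift α β ε ν hVU' w).app L).f j = 0 := by
      rw [← cancel_mono (CochainComplex.shiftXIso L 1 j (j + 1) rfl).hom, assoc,
        toShift_app_f_shiftXIso_hom, assoc, map_inlX_inlX_toShiftX, zero_comp]
    exact this
  · rintro _ j rfl
    have : j₂ _ j rfl ≫ ((toShift α β ε ν hVU' w).app L).f j ≫
        (CochainComplex.shiftXIso L 1 j (j + 1) rfl).hom = ε.app (L.X (j + 1)) := by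
      rw [toShift_app_f_shiftXIso_hom, assoc, map_inrX_inlX_toShiftX]
    exact this
  · rintro _ j rfl
    have : j₃ _ j rfl ≫ ((toShift α β ε ν hVU' w).app L).f j ≫
        (CochainComplex.shiftXIso L 1 j (j + 1) rfl).hom = ν.app (L.X (j + 1)) := by
      rw [toShift_app_f_shiftXIso_hom, assoc, map_inlX_inrX_toShiftX]
    exact this

/-- Dually, `V'U = 0` leaves the last three vertices of the square starting at `K`, and
`quasiIso_of_shortExact_ofShift` applies. -/
lemma quasiIso_ofShift_app (η : 𝟭 A ⟶ V ⋙ V') (θ : 𝟭 A ⟶ U ⋙ U')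
    (hV'U : ∀ X, IsZero (V'.obj (U.obj X)))
    (w : ∀ X, η.app X ≫ β.app (V.obj X) = θ.app X ≫ U'.map (α.app X))
    (hS : ∀ X, (CommSq.mk (w X)).shortComplex.ShortExact) (K : CochainComplex A ℤ) :
    QuasiIso ((ofShift α β η θ w).app K) := by
  let X₂ : CochainComplex A ℤ :=
    (V'.mapHomologicalComplex _).obj ((V.mapHomologicalComplex _).obj K)
  let X₃ : CochainComplex A ℤ :=
    (U'.mapHomologicalComplex _).obj ((U.mapHomologicalComplex _).obj K)
  let X₄ : CochainComplex A ℤ :=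
    (U'.mapHomologicalComplex _).obj ((V.mapHomologicalComplex _).obj K)
  let inl : X₂ ⟶ X₄ := (NatTrans.mapHomologicalComplex β (ComplexShape.up ℤ)).app
    ((V.mapHomologicalComplex _).obj K)
  let inr : X₃ ⟶ X₄ := (U'.mapHomologicalComplex _).map
    ((NatTrans.mapHomologicalComplex α (ComplexShape.up ℤ)).app K)
  let f : K ⟶ X₂ :=
    { f := fun i => η.app (K.X i), comm' := fun i j _ => (η.naturality (K.d i j)).symm }
  let g : K ⟶ X₃ :=
    { f := fun i => θ.app (K.X i), comm' := fun i j _ => (θ.naturality (K.d i j)).symm }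
  have sq : CommSq f g inl inr := ⟨by ext i; exact w (K.X i)⟩
  let j₂ (i j : ℤ) (h : j + 1 = i) :
      V'.obj (V.obj (K.X i)) ⟶ (β.coneFunctor.obj (α.coneFunctor.obj K)).X j :=
    V'.map (inrX α K i) ≫ inlX β _ i j h
  let j₃ (i j : ℤ) (h : j + 1 = i) :
      U'.obj (U.obj (K.X i)) ⟶ (β.coneFunctor.obj (α.coneFunctor.obj K)).X j :=
    U'.map (inlX α K i j h) ≫ inrX β _ j
  let j₄ (i : ℤ) : U'.obj (V.obj (K.X i)) ⟶ (β.coneFunctor.obj (α.coneFunctor.obj K)).X i :=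
    U'.map (inrX α K i) ≫ inrX β _ i
  have hj (j : ℤ) :
      IsIso (biprod.desc (biprod.desc (j₂ _ j rfl) (j₃ _ j rfl)) (j₄ j)) := by
    refine ⟨⟨biprod.lift (biprod.lift (fstX β _ j (j + 1) rfl ≫ V'.map (sndX α K _))
      (sndX β _ j ≫ U'.map (fstX α K _ _ rfl))) (sndX β _ j ≫ U'.map (sndX α K _)), ?_, ?_⟩⟩
    · apply biprod.hom_ext'
      · apply biprod.hom_ext'
        · apply biprod.hom_ext
          · apply biprod.hom_ext <;> simp [j₂]
          · simp [j₂]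
        · apply biprod.hom_ext
          · apply biprod.hom_ext <;> simp [j₃]
          · simp [j₃]
      · apply biprod.hom_ext
        · apply biprod.hom_ext <;> simp [j₄]
        · simp [j₄]
    · apply comp_hom_ext β α rfl rfl
      · exact (hV'U _).eq_of_src _ _
      · simp [j₂]
      · simp [j₃]
      · simp [j₄]
  refine CochainComplex.quasiIso_of_shortExact_ofShift sq
    (CochainComplex.shortExact_shortComplex_of_degreewise sq fun i => hS (K.X i)) _
    j₂ j₃ j₄ ?_ ?_ ?_ ?_ hj
  · rintro j _ _ rfl rfl
    exact (assoc _ _ _).trans (map_inrX_inlX_d' α β K _ _ _ rfl rfl)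
  · rintro j _ _ rfl rfl
    exact (assoc _ _ _).trans (map_inlX_inrX_d' α β K _ _ _ rfl rfl)
  · intro j i
    exact (assoc _ _ _).trans (map_inrX_inrX_d α β K _ _)
  · rintro _ j rfl
    exact ofShift_app_f α β η θ w K _ _ rfl

end CategoryTheory.NatTrans.coneFunctor

namespace CategoryTheory

variable {A : Type*} {B : Type*} [Category A] [Category B] [Abelian A] [Abelian B]

/-- A triangulated equivalence of derived categories obtained from the cones of two natural
transformations between exact functors. -/
theorem triangulatedEquivalent_of_coneFunctor
    [HasDerivedCategory.{w} A] [HasDerivedCategory.{w'} B]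
    {U V : A ⥤ B} [U.Additive] [V.Additive] [U.PreservesHomology] [V.PreservesHomology]
    {U' V' : B ⥤ A} [U'.Additive] [V'.Additive] [U'.PreservesHomology] [V'.PreservesHomology]
    (α : U ⟶ V) (β : V' ⟶ U') (ε : U' ⋙ U ⟶ 𝟭 B) (ν : V' ⋙ V ⟶ 𝟭 B)
    (η : 𝟭 A ⟶ V ⋙ V') (θ : 𝟭 A ⟶ U ⋙ U')
    (hVU' : ∀ Y, IsZero (V.obj (U'.obj Y))) (hV'U : ∀ X, IsZero (V'.obj (U.obj X)))
    (w₁ : ∀ Y, U.map (β.app Y) ≫ ε.app Y = α.app (V'.obj Y) ≫ ν.app Y)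
    (h₁ : ∀ Y, (CommSq.mk (w₁ Y)).shortComplex.ShortExact)
    (w₂ : ∀ X, η.app X ≫ β.app (V.obj X) = θ.app X ≫ U'.map (α.app X))
    (h₂ : ∀ X, (CommSq.mk (w₂ X)).shortComplex.ShortExact) :
    TriangulatedEquivalent (DerivedCategory A) (DerivedCategory B) := by
  have q₁ := NatTrans.coneFunctor.quasiIso_toShift_app α β ε ν hVU' w₁ h₁
  have q₂ := NatTrans.coneFunctor.quasiIso_ofShift_app α β η θ hV'U w₂ h₂
  let e₁ : shiftFunctor (CochainComplex A ℤ) (1 : ℤ) ⋙ DerivedCategory.Q ≅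
      (α.coneFunctor ⋙ β.coneFunctor) ⋙ DerivedCategory.Q :=
    NatIso.ofComponents
      (fun K => asIso (DerivedCategory.Q.map
        ((NatTrans.coneFunctor.ofShift α β η θ w₂).app K)))
      (fun φ => (Functor.whiskerRight
        (NatTrans.coneFunctor.ofShift α β η θ w₂) DerivedCategory.Q).naturality φ)
  let e₂ : (β.coneFunctor ⋙ α.coneFunctor) ⋙ DerivedCategory.Q ≅
      shiftFunctor (CochainComplex B ℤ) (1 : ℤ) ⋙ DerivedCategory.Q :=
    NatIso.ofComponents
      (fun L => asIso (DerivedCategory.Q.map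
        ((NatTrans.coneFunctor.toShift α β ε ν hVU' w₁).app L)))
      (fun φ => (Functor.whiskerRight
        (NatTrans.coneFunctor.toShift α β ε ν hVU' w₁) DerivedCategory.Q).naturality φ)
  exact triangulatedEquivalent_derivedCategory α.coneFunctor β.coneFunctor
    (fun _ _ φ _ => NatTrans.coneFunctor.quasiIso_map α φ)
    (fun _ _ φ _ => NatTrans.coneFunctor.quasiIso_map β φ)
    (fun _ _ φ => NatTrans.coneFunctor.mapTriangleIso α φ) e₁.symm e₂

end CategoryTheory

/-! ### Order-theoretic consequences of the hypotheses -/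

open Limits Category Preadditive Pretriangulated

section Gluing

variable {X : Type p} {Y : Type q} [PartialOrder Y] {S : X → Set Y}

/-- At most one element of `S x` lies below a given `y`; this makes the maps chosen below
independent of the choice. -/
lemma eq_of_le_of_le_of_disjoint_Ici
    (hup : ∀ x : X, ∀ y ∈ S x, ∀ y' ∈ S x, y ≠ y' → Set.Ici y ∩ Set.Ici y' = ∅)
    {x : X} {z w : S x} {y : Y} (hz : (z : Y) ≤ y) (hw : (w : Y) ≤ y) : z = w := by
  by_contra h
  have := hup x z z.2 w w.2 (fun h' => h (Subtype.ext h'))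
  exact (this ▸ (⟨hz, hw⟩ : y ∈ Set.Ici (z : Y) ∩ Set.Ici (w : Y)) : y ∈ (∅ : Set Y))

lemma eq_of_ge_of_ge_of_disjoint_Iic
    (hdown : ∀ x : X, ∀ y ∈ S x, ∀ y' ∈ S x, y ≠ y' → Set.Iic y ∩ Set.Iic y' = ∅)
    {x : X} {z w : S x} {y : Y} (hz : y ≤ z) (hw : y ≤ w) : z = w := by
  by_contra h
  have := hdown x z z.2 w w.2 (fun h' => h (Subtype.ext h'))
  exact (this ▸ (⟨hz, hw⟩ : y ∈ Set.Iic (z : Y) ∩ Set.Iic (w : Y)) : y ∈ (∅ : Set Y))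

variable [PartialOrder X]

/-- With its companion `exists_ge`, this is all that the diagram constructions use of the
bijections; uniqueness comes from disjointness. -/
lemma HasIncreasingBijections.exists_le (hφ : HasIncreasingBijections S) {x x' : X} (h : x ≤ x')
    (z' : S x') : ∃ z : S x, (z : Y) ≤ z' := by
  obtain ⟨φ, hφ⟩ := hφ x x' h
  exact ⟨φ.symm z', by simpa using hφ (φ.symm z')⟩

lemma HasIncreasingBijections.exists_ge (hφ : HasIncreasingBijections S) {x x' : X} (h : x ≤ x')
    (z : S x) : ∃ z' : S x', (z : Y) ≤ z' := by
  obtain ⟨φ, hφ⟩ := hφ x x' h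
  exact ⟨φ z, hφ z⟩

end Gluing

section

variable {P : Type*} [Preorder P] {A : Type*} [Category A] (F : P ⥤ A)

lemma CategoryTheory.Functor.map_homOfLE_comp_map_homOfLE {a b c : P} (h : a ≤ b) (h' : b ≤ c) :
    F.map (homOfLE h) ≫ F.map (homOfLE h') = F.map (homOfLE (h.trans h')) :=
  (F.map_comp _ _).symm

lemma CategoryTheory.Functor.map_homOfLE_comp_map_homOfLE_assoc {a b c : P} (h : a ≤ b)
    (h' : b ≤ c) {Z : A} (f : F.obj c ⟶ Z) :
    F.map (homOfLE h) ≫ F.map (homOfLE h') ≫ f = F.map (homOfLE (h.trans h')) ≫ f := by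
  rw [← assoc, F.map_homOfLE_comp_map_homOfLE]

lemma CategoryTheory.Functor.map_homOfLE_self {a : P} (h : a ≤ a) : F.map (homOfLE h) = 𝟙 _ :=
  F.map_id a

end

open CategoryTheory.Functor

/-! ### The functor of biproducts over the sets `S x` -/

section SumFunctor

variable {X : Type p} {Y : Type q} [PartialOrder X] [PartialOrder Y] {S : X → Set Y}
  (hup : ∀ x : X, ∀ y ∈ S x, ∀ y' ∈ S x, y ≠ y' → Set.Ici y ∩ Set.Ici y' = ∅)
  (hdown : ∀ x : X, ∀ y ∈ S x, ∀ y' ∈ S x, y ≠ y' → Set.Iic y ∩ Set.Iic y' = ∅)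
  (hφ : HasIncreasingBijections S) [∀ x, Finite (S x)]
  {A : Type*} [Category A] [Preadditive A] [HasFiniteBiproducts A]

/-- The biproduct of the values of a functor `N : Y ⥤ A` on the elements of `S x`. -/
noncomputable abbrev biproductOn (N : Y ⥤ A) (x : X) : A := ⨁ fun z : S x => N.obj (z : Y)

variable (S) in
/-- The projection from `biproductOn`. -/
noncomputable abbrev biproductOn.π (N : Y ⥤ A) (x : X) (z : S x) :
    biproductOn (S := S) N x ⟶ N.obj (z : Y) :=
  biproduct.π (fun z : S x => N.obj (z : Y)) z

variable (S) in
/-- The inclusion in `biproductOn`. -/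
noncomputable abbrev biproductOn.ι (N : Y ⥤ A) (x : X) (z : S x) :
    N.obj (z : Y) ⟶ biproductOn (S := S) N x :=
  biproduct.ι (fun z : S x => N.obj (z : Y)) z

/-- The transition maps between the objects `biproductOn N x`. -/
noncomputable def biproductOnMap (N : Y ⥤ A) {x x' : X} (h : x ≤ x') :
    biproductOn (S := S) N x ⟶ biproductOn (S := S) N x' :=
  biproduct.lift fun z' => biproductOn.π S N x (hφ.exists_le h z').choose ≫
    N.map (homOfLE (hφ.exists_le h z').choose_spec)

include hup in
-- The chosen element below `z'` is the only one, so any `z ≤ z'` computes the row of the matrix at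
-- `z'`.
lemma biproductOnMap_π (N : Y ⥤ A) {x x' : X} (h : x ≤ x') (z : S x) (z' : S x')
    (hz : (z : Y) ≤ z') : biproductOnMap hφ N h ≫ biproductOn.π S N x' z' =
      biproductOn.π S N x z ≫ N.map (homOfLE hz) := by
  obtain rfl := eq_of_le_of_le_of_disjoint_Ici hup hz (hφ.exists_le h z').choose_spec
  simp [biproductOnMap]

include hup hdown in
-- The column description: disjointness of down-sets gives at most one `z'` above `z`, and
-- disjointness of up-sets kills the entries from other elements of `S x` to `z'`.
lemma ι_biproductOnMap (N : Y ⥤ A) {x x' : X} (h : x ≤ x') (z : S x) (z' : S x')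
    (hz : (z : Y) ≤ z') : biproductOn.ι S N x z ≫ biproductOnMap hφ N h =
      N.map (homOfLE hz) ≫ biproductOn.ι S N x' z' := by
  classical
  refine biproduct.hom_ext _ _ fun w' => ?_
  obtain ⟨w, hw⟩ := hφ.exists_le h w'
  rw [assoc, assoc]
  refine (congr_arg _ (biproductOnMap_π hup hφ N h w w' hw)).trans ?_
  by_cases hzw : z = w
  · subst hzw
    obtain rfl := eq_of_ge_of_ge_of_disjoint_Iic hdown hz hw
    simp
  · rw [biproduct.ι_π_ne_assoc _ hzw, zero_comp, biproduct.ι_π_ne _ _, comp_zero]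
    rintro rfl
    exact hzw (eq_of_le_of_le_of_disjoint_Ici hup hz hw)

/-- The functor `X ⥤ A` which sends `x` to the biproduct of the values of `N : Y ⥤ A`
on `S x`. -/
noncomputable def biproductOnFunctor (N : Y ⥤ A) : X ⥤ A where
  obj x := biproductOn (S := S) N x
  map f := biproductOnMap hφ N (leOfHom f)
  map_id x := biproduct.hom_ext _ _ fun z => by
    refine (biproductOnMap_π hup hφ N le_rfl z z le_rfl).trans ?_
    rw [N.map_homOfLE_self, comp_id, id_comp]
  map_comp {x x' x''} f g := biproduct.hom_ext _ _ fun z'' => by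
    obtain ⟨z', hz'⟩ := hφ.exists_le (leOfHom g) z''
    obtain ⟨z, hz⟩ := hφ.exists_le (leOfHom f) z'
    refine (biproductOnMap_π hup hφ N (leOfHom (f ≫ g)) z z'' (hz.trans hz')).trans ?_
    rw [assoc]
    refine Eq.trans ?_ (congr_arg _ (biproductOnMap_π hup hφ N (leOfHom g) z' z'' hz')).symm
    rw [reassoc_of% (biproductOnMap_π hup hφ N (leOfHom f) z z' hz),
      N.map_homOfLE_comp_map_homOfLE]

end SumFunctor

/-! ### Diagrams on the glued posets as gluing data -/

section Glue

variable {X : Type p} {Y : Type q} [PartialOrder X] [PartialOrder Y] {S : X → Set Y}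
  {hφ : HasIncreasingBijections S} {A : Type*} [Category A]

namespace PlusPoset

/-- The element of `PlusPoset S hφ` given by an element of `X`. -/
abbrev inl (x : X) : PlusPoset S hφ := Sum.inl x

/-- The element of `PlusPoset S hφ` given by an element of `Y`. -/
abbrev inr (y : Y) : PlusPoset S hφ := Sum.inr y

lemma inl_le_inl {x x' : X} (h : x ≤ x') : (inl x : PlusPoset S hφ) ≤ inl x' := h

lemma inr_le_inr {y y' : Y} (h : y ≤ y') : (inr y : PlusPoset S hφ) ≤ inr y' := h

lemma le_of_inl_le_inl {x x' : X} (h : (inl x : PlusPoset S hφ) ≤ inl x') : x ≤ x' := h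

lemma le_of_inr_le_inr {y y' : Y} (h : (inr y : PlusPoset S hφ) ≤ inr y') : y ≤ y' := h

lemma inl_le_inr {x : X} (z : S x) {y : Y} (h : (z : Y) ≤ y) :
    (inl x : PlusPoset S hφ) ≤ inr y := ⟨z, z.2, h⟩

lemma exists_of_inl_le_inr {x : X} {y : Y} (h : (inl x : PlusPoset S hφ) ≤ inr y) :
    ∃ z : S x, (z : Y) ≤ y := by
  obtain ⟨z, hz, hzy⟩ := h
  exact ⟨⟨z, hz⟩, hzy⟩

variable (S hφ) in
/-- The inclusion of `X` in `PlusPoset S hφ`. -/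
def inlFunctor : X ⥤ PlusPoset S hφ where
  obj := inl
  map f := homOfLE (inl_le_inl (leOfHom f))

variable (S hφ) in
/-- The inclusion of `Y` in `PlusPoset S hφ`. -/
def inrFunctor : Y ⥤ PlusPoset S hφ where
  obj := inr
  map f := homOfLE (inr_le_inr (leOfHom f))

/-- Constructor for natural transformations between functors from `PlusPoset S hφ`. -/
def natTransMk {F G : PlusPoset S hφ ⥤ A} (l : ∀ x : X, F.obj (inl x) ⟶ G.obj (inl x))
    (r : ∀ y : Y, F.obj (inr y) ⟶ G.obj (inr y))
    (hl : ∀ (x x' : X) (h : x ≤ x'), F.map (homOfLE (inl_le_inl h)) ≫ l x' =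
      l x ≫ G.map (homOfLE (inl_le_inl h)))
    (hr : ∀ (y y' : Y) (h : y ≤ y'), F.map (homOfLE (inr_le_inr h)) ≫ r y' =
      r y ≫ G.map (homOfLE (inr_le_inr h)))
    (hc : ∀ (x : X) (z : S x) (y : Y) (h : (z : Y) ≤ y), F.map (homOfLE (inl_le_inr z h)) ≫ r y =
      l x ≫ G.map (homOfLE (inl_le_inr z h))) : F ⟶ G where
  app
    | Sum.inl x => l x
    | Sum.inr y => r y
  naturality := by
    rintro (x | y) (x' | y') f
    · exact hl x x' (le_of_inl_le_inl (leOfHom f))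
    · obtain ⟨z, hz⟩ := exists_of_inl_le_inr (leOfHom f)
      exact hc x z y' hz
    · exact (leOfHom f).elim
    · exact hr y y' (le_of_inr_le_inr (leOfHom f))

/-- The map of the functor `glue`. -/
def glueMap (M : X ⥤ A) (N : Y ⥤ A)
    (g : ∀ (x : X) (y : Y), (inl x : PlusPoset S hφ) ≤ inr y → (M.obj x ⟶ N.obj y)) :
    ∀ (a b : PlusPoset S hφ) (_ : a ≤ b),
      ((Sum.elim M.obj N.obj a : A) ⟶ Sum.elim M.obj N.obj b)
  | Sum.inl _, Sum.inl _, h => M.map (homOfLE h)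
  | Sum.inl x, Sum.inr y, h => g x y h
  | Sum.inr _, Sum.inl _, h => h.elim
  | Sum.inr _, Sum.inr _, h => N.map (homOfLE h)

/-- Functors from `PlusPoset S hφ` can be obtained by gluing functors from `X` and `Y`. -/
def glue (M : X ⥤ A) (N : Y ⥤ A)
    (g : ∀ (x : X) (y : Y), (inl x : PlusPoset S hφ) ≤ inr y → (M.obj x ⟶ N.obj y))
    (hg : ∀ (x x' : X) (y : Y) (h : x ≤ x') (h' : (inl x' : PlusPoset S hφ) ≤ inr y),
      M.map (homOfLE h) ≫ g x' y h' = g x y ((inl_le_inl h).trans h'))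
    (hg' : ∀ (x : X) (y y' : Y) (h : (inl x : PlusPoset S hφ) ≤ inr y) (h' : y ≤ y'),
      g x y h ≫ N.map (homOfLE h') = g x y' (h.trans (inr_le_inr h'))) :
    PlusPoset S hφ ⥤ A where
  obj := Sum.elim M.obj N.obj
  map {a b} f := glueMap M N g a b (leOfHom f)
  map_id := by
    rintro (x | y)
    · exact M.map_id x
    · exact N.map_id y
  map_comp := by
    rintro (a | a) (b | b) (c | c) f g
    · exact M.map_comp (homOfLE (le_of_inl_le_inl (leOfHom f)))
        (homOfLE (le_of_inl_le_inl (leOfHom g)))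
    · exact (hg _ _ _ _ _).symm
    · exact (leOfHom g).elim
    · exact (hg' _ _ _ _ _).symm
    · exact (leOfHom f).elim
    · exact (leOfHom f).elim
    · exact (leOfHom g).elim
    · exact N.map_comp (homOfLE (le_of_inr_le_inr (leOfHom f)))
        (homOfLE (le_of_inr_le_inr (leOfHom g)))

end PlusPoset

namespace MinusPoset

/-- The element of `MinusPoset S hφ` given by an element of `X`. -/
abbrev inl (x : X) : MinusPoset S hφ := Sum.inl x

/-- The element of `MinusPoset S hφ` given by an element of `Y`. -/
abbrev inr (y : Y) : MinusPoset S hφ := Sum.inr y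

lemma inl_le_inl {x x' : X} (h : x ≤ x') : (inl x : MinusPoset S hφ) ≤ inl x' := h

lemma inr_le_inr {y y' : Y} (h : y ≤ y') : (inr y : MinusPoset S hφ) ≤ inr y' := h

lemma le_of_inl_le_inl {x x' : X} (h : (inl x : MinusPoset S hφ) ≤ inl x') : x ≤ x' := h

lemma le_of_inr_le_inr {y y' : Y} (h : (inr y : MinusPoset S hφ) ≤ inr y') : y ≤ y' := h

lemma inr_le_inl {x : X} (z : S x) {y : Y} (h : y ≤ z) :
    (inr y : MinusPoset S hφ) ≤ inl x := ⟨z, z.2, h⟩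

lemma exists_of_inr_le_inl {x : X} {y : Y} (h : (inr y : MinusPoset S hφ) ≤ inl x) :
    ∃ z : S x, y ≤ z := by
  obtain ⟨z, hz, hzy⟩ := h
  exact ⟨⟨z, hz⟩, hzy⟩

variable (S hφ) in
/-- The inclusion of `X` in `MinusPoset S hφ`. -/
def inlFunctor : X ⥤ MinusPoset S hφ where
  obj := inl
  map f := homOfLE (inl_le_inl (leOfHom f))

variable (S hφ) in
/-- The inclusion of `Y` in `MinusPoset S hφ`. -/
def inrFunctor : Y ⥤ MinusPoset S hφ where
  obj := inr
  map f := homOfLE (inr_le_inr (leOfHom f))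

/-- Constructor for natural transformations between functors from `MinusPoset S hφ`. -/
def natTransMk {F G : MinusPoset S hφ ⥤ A} (l : ∀ x : X, F.obj (inl x) ⟶ G.obj (inl x))
    (r : ∀ y : Y, F.obj (inr y) ⟶ G.obj (inr y))
    (hl : ∀ (x x' : X) (h : x ≤ x'), F.map (homOfLE (inl_le_inl h)) ≫ l x' =
      l x ≫ G.map (homOfLE (inl_le_inl h)))
    (hr : ∀ (y y' : Y) (h : y ≤ y'), F.map (homOfLE (inr_le_inr h)) ≫ r y' =
      r y ≫ G.map (homOfLE (inr_le_inr h)))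
    (hc : ∀ (x : X) (z : S x) (y : Y) (h : y ≤ z), F.map (homOfLE (inr_le_inl z h)) ≫ l x =
      r y ≫ G.map (homOfLE (inr_le_inl z h))) : F ⟶ G where
  app
    | Sum.inl x => l x
    | Sum.inr y => r y
  naturality := by
    rintro (x | y) (x' | y') f
    · exact hl x x' (le_of_inl_le_inl (leOfHom f))
    · exact (leOfHom f).elim
    · obtain ⟨z, hz⟩ := exists_of_inr_le_inl (leOfHom f)
      exact hc x' z y hz
    · exact hr y y' (le_of_inr_le_inr (leOfHom f))

/-- The map of the functor `glue`. -/
def glueMap (M : X ⥤ A) (N : Y ⥤ A)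
    (g : ∀ (x : X) (y : Y), (inr y : MinusPoset S hφ) ≤ inl x → (N.obj y ⟶ M.obj x)) :
    ∀ (a b : MinusPoset S hφ) (_ : a ≤ b),
      ((Sum.elim M.obj N.obj a : A) ⟶ Sum.elim M.obj N.obj b)
  | Sum.inl _, Sum.inl _, h => M.map (homOfLE h)
  | Sum.inl _, Sum.inr _, h => h.elim
  | Sum.inr y, Sum.inl x, h => g x y h
  | Sum.inr _, Sum.inr _, h => N.map (homOfLE h)

/-- Functors from `MinusPoset S hφ` can be obtained by gluing functors from `X` and `Y`. -/
def glue (M : X ⥤ A) (N : Y ⥤ A)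
    (g : ∀ (x : X) (y : Y), (inr y : MinusPoset S hφ) ≤ inl x → (N.obj y ⟶ M.obj x))
    (hg : ∀ (x x' : X) (y : Y) (h' : (inr y : MinusPoset S hφ) ≤ inl x) (h : x ≤ x'),
      g x y h' ≫ M.map (homOfLE h) = g x' y (h'.trans (inl_le_inl h)))
    (hg' : ∀ (x : X) (y y' : Y) (h' : y ≤ y') (h : (inr y' : MinusPoset S hφ) ≤ inl x),
      N.map (homOfLE h') ≫ g x y' h = g x y ((inr_le_inr h').trans h)) :
    MinusPoset S hφ ⥤ A where
  obj := Sum.elim M.obj N.obj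
  map {a b} f := glueMap M N g a b (leOfHom f)
  map_id := by
    rintro (x | y)
    · exact M.map_id x
    · exact N.map_id y
  map_comp := by
    rintro (a | a) (b | b) (c | c) f g
    · exact M.map_comp (homOfLE (le_of_inl_le_inl (leOfHom f)))
        (homOfLE (le_of_inl_le_inl (leOfHom g)))
    · exact (leOfHom g).elim
    · exact (leOfHom f).elim
    · exact (leOfHom f).elim
    · exact (hg _ _ _ _ _).symm
    · exact (leOfHom g).elim
    · exact (hg' _ _ _ _ _).symm
    · exact N.map_comp (homOfLE (le_of_inr_le_inr (leOfHom f)))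
        (homOfLE (le_of_inr_le_inr (leOfHom g)))

end MinusPoset

end Glue

/-! ### Extension by zero from `X` and by biproducts from `Y` -/

open Limits Category Preadditive Pretriangulated CategoryTheory.Functor ZeroObject

section

variable {X : Type p} {Y : Type q} [PartialOrder X] [PartialOrder Y] {S : X → Set Y}
  (hup : ∀ x : X, ∀ y ∈ S x, ∀ y' ∈ S x, y ≠ y' → Set.Ici y ∩ Set.Ici y' = ∅)
  (hdown : ∀ x : X, ∀ y ∈ S x, ∀ y' ∈ S x, y ≠ y' → Set.Iic y ∩ Set.Iic y' = ∅)
  {hφ : HasIncreasingBijections S} {A : Type*} [Category A]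

lemma PlusPoset.natTrans_ext {F G : PlusPoset S hφ ⥤ A} {f g : F ⟶ G}
    (hl : ∀ x : X, f.app (inl x) = g.app (inl x)) (hr : ∀ y : Y, f.app (inr y) = g.app (inr y)) :
    f = g := by
  ext (x | y)
  · exact hl x
  · exact hr y

lemma MinusPoset.natTrans_ext {F G : MinusPoset S hφ ⥤ A} {f g : F ⟶ G}
    (hl : ∀ x : X, f.app (inl x) = g.app (inl x)) (hr : ∀ y : Y, f.app (inr y) = g.app (inr y)) :
    f = g := by
  ext (x | y)
  · exact hl x
  · exact hr y

variable [Abelian A]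

attribute [local instance] Abelian.hasFiniteBiproducts

variable (S hφ A) in
/-- The functor which extends functors `X ⥤ A` by zero on `Y`. -/
noncomputable def PlusPoset.extendX : (X ⥤ A) ⥤ (PlusPoset S hφ ⥤ A) where
  obj M := glue M ((Functor.const Y).obj 0) (fun _ _ _ => 0) (fun _ _ _ _ _ => comp_zero)
    (fun _ _ _ _ _ => zero_comp)
  map f := natTransMk (fun x => f.app x) (fun _ => 𝟙 _) (fun _ _ _ => f.naturality _)
    (fun _ _ _ => rfl) (fun _ _ _ _ => (isZero_zero A).eq_of_tgt _ _)
  map_id _ := natTrans_ext (fun _ => rfl) (fun _ => rfl)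
  map_comp _ _ := natTrans_ext (fun _ => rfl) (fun _ => (comp_id _).symm)

variable (S hφ A) in
/-- The functor which extends functors `X ⥤ A` by zero on `Y`. -/
noncomputable def MinusPoset.extendX : (X ⥤ A) ⥤ (MinusPoset S hφ ⥤ A) where
  obj M := glue M ((Functor.const Y).obj 0) (fun _ _ _ => 0) (fun _ _ _ _ _ => zero_comp)
    (fun _ _ _ _ _ => comp_zero)
  map f := natTransMk (fun x => f.app x) (fun _ => 𝟙 _) (fun _ _ _ => f.naturality _)
    (fun _ _ _ => rfl) (fun _ _ _ _ => (isZero_zero A).eq_of_src _ _)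
  map_id _ := natTrans_ext (fun _ => rfl) (fun _ => rfl)
  map_comp _ _ := natTrans_ext (fun _ => rfl) (fun _ => (comp_id _).symm)

variable [∀ x, Finite (S x)]

variable (S) in
/-- The map between biproducts induced by a natural transformation. -/
noncomputable abbrev biproductOn.map {N N' : Y ⥤ A} (f : N ⟶ N') (x : X) :
    biproductOn (S := S) N x ⟶ biproductOn (S := S) N' x :=
  biproduct.map fun z : S x => f.app (z : Y)

omit [PartialOrder X] in
lemma biproductOn.map_id (N : Y ⥤ A) (x : X) : biproductOn.map S (𝟙 N) x = 𝟙 _ :=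
  biproduct.hom_ext _ _ fun z => by simp

omit [PartialOrder X] in
lemma biproductOn.map_comp {N N' N'' : Y ⥤ A} (f : N ⟶ N') (g : N' ⟶ N'') (x : X) :
    biproductOn.map S (f ≫ g) x = biproductOn.map S f x ≫ biproductOn.map S g x :=
  biproduct.hom_ext _ _ fun z => by simp

include hup in
lemma biproductOnMap_naturality {N N' : Y ⥤ A} (f : N ⟶ N') {x x' : X} (h : x ≤ x') :
    biproductOnMap hφ N h ≫ biproductOn.map S f x' =
      biproductOn.map S f x ≫ biproductOnMap hφ N' h := by
  refine biproduct.hom_ext _ _ fun z' => ?_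
  obtain ⟨z, hz⟩ := hφ.exists_le h z'
  simp [reassoc_of% (biproductOnMap_π hup hφ N h z z' hz), biproductOnMap_π hup hφ N' h z z' hz]

namespace PlusPoset

/-- The map `⨁ N ⟶ N.obj y` for `N : Y ⥤ A` and `x ≤ y` in `PlusPoset S hφ`. -/
noncomputable def fromBiproductOn (N : Y ⥤ A) (x : X) (y : Y)
    (h : (inl x : PlusPoset S hφ) ≤ inr y) : biproductOn (S := S) N x ⟶ N.obj y :=
  biproductOn.π S N x (exists_of_inl_le_inr h).choose ≫
    N.map (homOfLE (exists_of_inl_le_inr h).choose_spec)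

include hup

lemma fromBiproductOn_eq (N : Y ⥤ A) (x : X) (y : Y) (h : (inl x : PlusPoset S hφ) ≤ inr y)
    (z : S x) (hz : (z : Y) ≤ y) :
    fromBiproductOn N x y h = biproductOn.π S N x z ≫ N.map (homOfLE hz) := by
  obtain rfl := eq_of_le_of_le_of_disjoint_Ici hup hz (exists_of_inl_le_inr h).choose_spec
  rfl

lemma biproductOnMap_fromBiproductOn (N : Y ⥤ A) (x x' : X) (y : Y) (h : x ≤ x')
    (h' : (inl x' : PlusPoset S hφ) ≤ inr y) :
    biproductOnMap hφ N h ≫ fromBiproductOn N x' y h' =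
      fromBiproductOn N x y ((inl_le_inl h).trans h') := by
  obtain ⟨z', hz'⟩ := exists_of_inl_le_inr h'
  obtain ⟨z, hz⟩ := hφ.exists_le h z'
  rw [fromBiproductOn_eq hup N x' y h' z' hz', fromBiproductOn_eq hup N x y _ z (hz.trans hz'),
    reassoc_of% (biproductOnMap_π hup hφ N h z z' hz), N.map_homOfLE_comp_map_homOfLE]

lemma fromBiproductOn_map (N : Y ⥤ A) (x : X) (y y' : Y) (h : (inl x : PlusPoset S hφ) ≤ inr y)
    (h' : y ≤ y') : fromBiproductOn N x y h ≫ N.map (homOfLE h') =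
      fromBiproductOn N x y' (h.trans (inr_le_inr h')) := by
  obtain ⟨z, hz⟩ := exists_of_inl_le_inr h
  rw [fromBiproductOn_eq hup N x y h z hz, fromBiproductOn_eq hup N x y' _ z (hz.trans h'),
    assoc, N.map_homOfLE_comp_map_homOfLE]

lemma fromBiproductOn_naturality {N N' : Y ⥤ A} (f : N ⟶ N') (x : X) (y : Y)
    (h : (inl x : PlusPoset S hφ) ≤ inr y) :
    fromBiproductOn N x y h ≫ f.app y = biproductOn.map S f x ≫ fromBiproductOn N' x y h := by
  obtain ⟨z, hz⟩ := exists_of_inl_le_inr h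
  simp [fromBiproductOn_eq hup _ x y h z hz]

omit hup

variable (hφ) in
/-- The extension of a functor `N : Y ⥤ A` to `X` by biproducts. -/
noncomputable abbrev extendYObj (N : Y ⥤ A) : PlusPoset S hφ ⥤ A :=
  glue (biproductOnFunctor hup hφ N) N (fromBiproductOn N)
    (biproductOnMap_fromBiproductOn hup N) (fromBiproductOn_map hup N)

variable (hφ) in
/-- The natural transformation between the functors `extendYObj` induced by a
natural transformation. -/
noncomputable abbrev extendYMap {N N' : Y ⥤ A} (f : N ⟶ N') :
    extendYObj hup hφ N ⟶ extendYObj hup hφ N' :=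
  natTransMk (biproductOn.map S f) (fun y => f.app y)
    (fun _ _ h => biproductOnMap_naturality hup (hφ := hφ) f h) (fun _ _ _ => f.naturality _)
    (fun x z y h => fromBiproductOn_naturality hup (hφ := hφ) f x y (inl_le_inr z h))

variable (hφ A) in
/-- The functor which extends functors `Y ⥤ A` to `X` by biproducts. -/
noncomputable def extendY : (Y ⥤ A) ⥤ (PlusPoset S hφ ⥤ A) where
  obj N := extendYObj hup hφ N
  map f := extendYMap hup hφ f
  map_id N := natTrans_ext (f := extendYMap hup hφ (𝟙 N)) (g := 𝟙 _)
    (fun x => biproductOn.map_id (S := S) N x) (fun _ => rfl)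
  map_comp f g := natTrans_ext (f := extendYMap hup hφ (f ≫ g))
    (g := extendYMap hup hφ f ≫ extendYMap hup hφ g)
    (fun x => biproductOn.map_comp (S := S) f g x) (fun _ => rfl)

end PlusPoset

namespace MinusPoset

/-- The map `N.obj y ⟶ ⨁ N` for `N : Y ⥤ A` and `y ≤ x` in `MinusPoset S hφ`. -/
noncomputable def toBiproductOn (N : Y ⥤ A) (x : X) (y : Y)
    (h : (inr y : MinusPoset S hφ) ≤ inl x) : N.obj y ⟶ biproductOn (S := S) N x :=
  N.map (homOfLE (exists_of_inr_le_inl h).choose_spec) ≫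
    biproductOn.ι S N x (exists_of_inr_le_inl h).choose

include hdown in
lemma toBiproductOn_eq (N : Y ⥤ A) (x : X) (y : Y) (h : (inr y : MinusPoset S hφ) ≤ inl x)
    (z : S x) (hz : y ≤ z) :
    toBiproductOn N x y h = N.map (homOfLE hz) ≫ biproductOn.ι S N x z := by
  obtain rfl := eq_of_ge_of_ge_of_disjoint_Iic hdown hz (exists_of_inr_le_inl h).choose_spec
  rfl

include hup hdown in
-- A map into the biproduct must be followed through a column of the transition matrix; hence both
-- disjointness conditions intervene, whereas `≤₊` only needs rows.
lemma toBiproductOn_biproductOnMap (N : Y ⥤ A) (x x' : X) (y : Y)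
    (h' : (inr y : MinusPoset S hφ) ≤ inl x) (h : x ≤ x') :
    toBiproductOn N x y h' ≫ biproductOnMap hφ N h =
      toBiproductOn N x' y (h'.trans (inl_le_inl h)) := by
  obtain ⟨z, hz⟩ := exists_of_inr_le_inl h'
  obtain ⟨z', hz'⟩ := hφ.exists_ge h z
  rw [toBiproductOn_eq hdown N x y h' z hz, toBiproductOn_eq hdown N x' y _ z' (hz.trans hz'),
    assoc, ι_biproductOnMap hup hdown hφ N h z z' hz', N.map_homOfLE_comp_map_homOfLE_assoc]

include hdown in
lemma map_toBiproductOn (N : Y ⥤ A) (x : X) (y y' : Y) (h' : y ≤ y')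
    (h : (inr y' : MinusPoset S hφ) ≤ inl x) :
    N.map (homOfLE h') ≫ toBiproductOn N x y' h =
      toBiproductOn N x y ((inr_le_inr h').trans h) := by
  obtain ⟨z, hz⟩ := exists_of_inr_le_inl h
  rw [toBiproductOn_eq hdown N x y' h z hz, toBiproductOn_eq hdown N x y _ z (h'.trans hz),
    N.map_homOfLE_comp_map_homOfLE_assoc]

include hdown in
lemma toBiproductOn_naturality {N N' : Y ⥤ A} (f : N ⟶ N') (x : X) (y : Y)
    (h : (inr y : MinusPoset S hφ) ≤ inl x) :
    toBiproductOn N x y h ≫ biproductOn.map S f x = f.app y ≫ toBiproductOn N' x y h := by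
  obtain ⟨z, hz⟩ := exists_of_inr_le_inl h
  simp [toBiproductOn_eq hdown _ x y h z hz]

variable (hφ) in
/-- The extension of a functor `N : Y ⥤ A` to `X` by biproducts. -/
noncomputable abbrev extendYObj (N : Y ⥤ A) : MinusPoset S hφ ⥤ A :=
  glue (biproductOnFunctor hup hφ N) N (toBiproductOn N)
    (toBiproductOn_biproductOnMap hup hdown N) (map_toBiproductOn hdown N)

variable (hφ) in
/-- The natural transformation between the functors `extendYObj` induced by a
natural transformation. -/
noncomputable abbrev extendYMap {N N' : Y ⥤ A} (f : N ⟶ N') :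
    extendYObj hup hdown hφ N ⟶ extendYObj hup hdown hφ N' :=
  natTransMk (biproductOn.map S f) (fun y => f.app y)
    (fun _ _ h => biproductOnMap_naturality hup (hφ := hφ) f h) (fun _ _ _ => f.naturality _)
    (fun x z y h => toBiproductOn_naturality hdown (hφ := hφ) f x y (inr_le_inl z h))

variable (hφ A) in
/-- The functor which extends functors `Y ⥤ A` to `X` by biproducts. -/
noncomputable def extendY : (Y ⥤ A) ⥤ (MinusPoset S hφ ⥤ A) where
  obj N := extendYObj hup hdown hφ N
  map f := extendYMap hup hdown hφ f
  map_id N := natTrans_ext (f := extendYMap hup hdown hφ (𝟙 N)) (g := 𝟙 _)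
    (fun x => biproductOn.map_id (S := S) N x) (fun _ => rfl)
  map_comp f g := natTrans_ext (f := extendYMap hup hdown hφ (f ≫ g))
    (g := extendYMap hup hdown hφ f ≫ extendYMap hup hdown hφ g)
    (fun x => biproductOn.map_comp (S := S) f g x) (fun _ => rfl)

end MinusPoset

end

/-! ### The four functors between the two diagram categories, and their natural transformations -/

open Limits Category Preadditive Pretriangulated CategoryTheory.Functor ZeroObject

section

variable {X : Type p} {Y : Type q} [PartialOrder X] [PartialOrder Y] {S : X → Set Y}
  (hup : ∀ x : X, ∀ y ∈ S x, ∀ y' ∈ S x, y ≠ y' → Set.Ici y ∩ Set.Ici y' = ∅)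
  (hdown : ∀ x : X, ∀ y ∈ S x, ∀ y' ∈ S x, y ≠ y' → Set.Iic y ∩ Set.Iic y' = ∅)
  {hφ : HasIncreasingBijections S} {A : Type*} [Category A] [Abelian A]

attribute [local instance] Abelian.hasFiniteBiproducts

namespace PlusPoset

variable (S hφ A) in
/-- The restriction to `X` followed by the extension by zero to `MinusPoset S hφ`. -/
noncomputable abbrev toMinusX : (PlusPoset S hφ ⥤ A) ⥤ (MinusPoset S hφ ⥤ A) :=
  (whiskeringLeft _ _ A).obj (inlFunctor S hφ) ⋙ MinusPoset.extendX S hφ A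

variable [∀ x, Finite (S x)]

variable (hφ A) in
/-- The restriction to `Y` followed by the extension by biproducts to `MinusPoset S hφ`. -/
noncomputable abbrev toMinusY : (PlusPoset S hφ ⥤ A) ⥤ (MinusPoset S hφ ⥤ A) :=
  (whiskeringLeft _ _ A).obj (inrFunctor S hφ) ⋙ MinusPoset.extendY hup hdown hφ A

/-- The map from the value of a functor at `x : X` to the biproduct of its values on `S x`. -/
noncomputable def liftBiproductOn (K : PlusPoset S hφ ⥤ A) (x : X) :
    K.obj (inl x) ⟶ biproductOn (S := S) (inrFunctor S hφ ⋙ K) x :=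
  biproduct.lift fun z => K.map (homOfLE (inl_le_inr z le_rfl))

lemma liftBiproductOn_π (K : PlusPoset S hφ ⥤ A) (x : X) (z : S x) :
    liftBiproductOn K x ≫ biproductOn.π S (inrFunctor S hφ ⋙ K) x z =
      K.map (homOfLE (inl_le_inr z le_rfl)) :=
  biproduct.lift_π _ _

include hup in
-- After projection to `z'`, both sides are the structure map of `K` for `x ≤ z'`, reached through
-- `x'` or through the `z ∈ S x` below `z'`.
lemma map_liftBiproductOn (K : PlusPoset S hφ ⥤ A) (x x' : X) (h : x ≤ x') :
    K.map (homOfLE (inl_le_inl h)) ≫ liftBiproductOn K x' =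
      liftBiproductOn K x ≫ biproductOnMap hφ (inrFunctor S hφ ⋙ K) h := by
  refine biproduct.hom_ext _ _ fun z' => ?_
  obtain ⟨z, hz⟩ := hφ.exists_le h z'
  rw [assoc, assoc]
  refine (congr_arg _ (liftBiproductOn_π K x' z')).trans ?_
  refine Eq.trans ?_ (congr_arg _ (biproductOnMap_π hup hφ _ h z z' hz)).symm
  rw [reassoc_of% (liftBiproductOn_π K x z)]
  exact (K.map_homOfLE_comp_map_homOfLE _ _).trans (K.map_homOfLE_comp_map_homOfLE _ _).symm

include hup in
lemma liftBiproductOn_fromBiproductOn (K : PlusPoset S hφ ⥤ A) (x : X) (y : Y)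
    (h : (inl x : PlusPoset S hφ) ≤ inr y) :
    liftBiproductOn K x ≫ fromBiproductOn (inrFunctor S hφ ⋙ K) x y h = K.map (homOfLE h) := by
  obtain ⟨z, hz⟩ := exists_of_inl_le_inr h
  rw [fromBiproductOn_eq hup _ x y h z hz, reassoc_of% (liftBiproductOn_π K x z)]
  exact K.map_homOfLE_comp_map_homOfLE _ _

lemma liftBiproductOn_naturality {K K' : PlusPoset S hφ ⥤ A} (f : K ⟶ K') (x : X) :
    f.app (inl x) ≫ liftBiproductOn K' x =
      liftBiproductOn K x ≫ biproductOn.map S (whiskerLeft (inrFunctor S hφ) f) x := by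
  refine biproduct.hom_ext _ _ fun z => ?_
  rw [assoc, assoc, biproduct.map_π]
  refine (congr_arg _ (liftBiproductOn_π K' x z)).trans ?_
  rw [reassoc_of% (liftBiproductOn_π K x z)]
  exact (f.naturality _).symm

end PlusPoset

namespace MinusPoset

variable (S hφ A) in
/-- The restriction to `X` followed by the extension by zero to `PlusPoset S hφ`. -/
noncomputable abbrev toPlusX : (MinusPoset S hφ ⥤ A) ⥤ (PlusPoset S hφ ⥤ A) :=
  (whiskeringLeft _ _ A).obj (inlFunctor S hφ) ⋙ PlusPoset.extendX S hφ A

variable [∀ x, Finite (S x)]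

variable (hφ A) in
/-- The restriction to `Y` followed by the extension by biproducts to `PlusPoset S hφ`. -/
noncomputable abbrev toPlusY : (MinusPoset S hφ ⥤ A) ⥤ (PlusPoset S hφ ⥤ A) :=
  (whiskeringLeft _ _ A).obj (inrFunctor S hφ) ⋙ PlusPoset.extendY hup hφ A

/-- The map from the biproduct of the values of a functor on `S x` to its value at `x : X`. -/
noncomputable def descBiproductOn (L : MinusPoset S hφ ⥤ A) (x : X) :
    biproductOn (S := S) (inrFunctor S hφ ⋙ L) x ⟶ L.obj (inl x) :=
  biproduct.desc fun z => L.map (homOfLE (inr_le_inl z le_rfl))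

lemma ι_descBiproductOn (L : MinusPoset S hφ ⥤ A) (x : X) (z : S x) :
    biproductOn.ι S (inrFunctor S hφ ⋙ L) x z ≫ descBiproductOn L x =
      L.map (homOfLE (inr_le_inl z le_rfl)) :=
  biproduct.ι_desc _ _

include hup hdown in
lemma biproductOnMap_descBiproductOn (L : MinusPoset S hφ ⥤ A) (x x' : X) (h : x ≤ x') :
    biproductOnMap hφ (inrFunctor S hφ ⋙ L) h ≫ descBiproductOn L x' =
      descBiproductOn L x ≫ L.map (homOfLE (inl_le_inl h)) := by
  refine biproduct.hom_ext' _ _ fun z => ?_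
  obtain ⟨z', hz⟩ := hφ.exists_ge h z
  rw [reassoc_of% (ι_biproductOnMap hup hdown hφ (inrFunctor S hφ ⋙ L) h z z' hz),
    reassoc_of% (ι_descBiproductOn L x z)]
  refine (congr_arg _ (ι_descBiproductOn L x' z')).trans ?_
  exact (L.map_homOfLE_comp_map_homOfLE _ _).trans (L.map_homOfLE_comp_map_homOfLE _ _).symm

include hdown in
lemma toBiproductOn_descBiproductOn (L : MinusPoset S hφ ⥤ A) (x : X) (y : Y)
    (h : (inr y : MinusPoset S hφ) ≤ inl x) :
    toBiproductOn (inrFunctor S hφ ⋙ L) x y h ≫ descBiproductOn L x = L.map (homOfLE h) := by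
  obtain ⟨z, hz⟩ := exists_of_inr_le_inl h
  rw [toBiproductOn_eq hdown _ x y h z hz, assoc]
  refine (congr_arg _ (ι_descBiproductOn L x z)).trans ?_
  exact L.map_homOfLE_comp_map_homOfLE _ _

lemma descBiproductOn_naturality {L L' : MinusPoset S hφ ⥤ A} (f : L ⟶ L') (x : X) :
    biproductOn.map S (whiskerLeft (inrFunctor S hφ) f) x ≫ descBiproductOn L' x =
      descBiproductOn L x ≫ f.app (inl x) := by
  refine biproduct.hom_ext' _ _ fun z => ?_
  rw [biproduct.ι_map_assoc, reassoc_of% (ι_descBiproductOn L x z)]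
  refine (congr_arg _ (ι_descBiproductOn L' x z)).trans ?_
  exact (f.naturality _).symm

end MinusPoset

variable [∀ x, Finite (S x)]

namespace PlusPoset

/-- The component of `toMinusXToMinusY`. -/
noncomputable def toMinusXToMinusYApp (K : PlusPoset S hφ ⥤ A) :
    (toMinusX S hφ A).obj K ⟶ (toMinusY hup hdown hφ A).obj K :=
  MinusPoset.natTransMk (F := (toMinusX S hφ A).obj K) (G := (toMinusY hup hdown hφ A).obj K)
    (fun x => liftBiproductOn K x) (fun _ => 0)
    (fun x x' h => map_liftBiproductOn hup K x x' h)
    (fun _ _ _ => (isZero_zero A).eq_of_src _ _) (fun _ _ _ _ => (isZero_zero A).eq_of_src _ _)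

variable (hφ A) in
/-- The natural transformation from `toMinusX` to `toMinusY`. -/
noncomputable def toMinusXToMinusY : toMinusX S hφ A ⟶ toMinusY hup hdown hφ A where
  app K := toMinusXToMinusYApp hup hdown K
  naturality K K' f := MinusPoset.natTrans_ext
    (f := (toMinusX S hφ A).map f ≫ toMinusXToMinusYApp hup hdown K')
    (g := toMinusXToMinusYApp hup hdown K ≫ (toMinusY hup hdown hφ A).map f)
    (fun x => liftBiproductOn_naturality f x) (fun _ => (isZero_zero A).eq_of_src _ _)

/-- The component of `toPlusXUnit`. -/
noncomputable def toPlusXUnitApp (K : PlusPoset S hφ ⥤ A) :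
    K ⟶ (toMinusX S hφ A ⋙ MinusPoset.toPlusX S hφ A).obj K :=
  natTransMk (G := (toMinusX S hφ A ⋙ MinusPoset.toPlusX S hφ A).obj K)
    (fun x => 𝟙 (K.obj (inl x))) (fun _ => 0)
    (fun _ _ _ => (comp_id _).trans (id_comp _).symm)
    (fun _ _ _ => (isZero_zero A).eq_of_tgt _ _) (fun _ _ _ _ => (isZero_zero A).eq_of_tgt _ _)

variable (S hφ A) in
/-- The unit of the restriction to `X`. -/
noncomputable def toPlusXUnit : 𝟭 _ ⟶ toMinusX S hφ A ⋙ MinusPoset.toPlusX S hφ A where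
  app K := toPlusXUnitApp K
  naturality K K' f := natTrans_ext (f := f ≫ toPlusXUnitApp K')
    (g := toPlusXUnitApp K ≫ (toMinusX S hφ A ⋙ MinusPoset.toPlusX S hφ A).map f)
    (fun _ => (comp_id _).trans (id_comp _).symm) (fun _ => (isZero_zero A).eq_of_tgt _ _)

/-- The component of `toPlusYUnit`. -/
noncomputable def toPlusYUnitApp (K : PlusPoset S hφ ⥤ A) :
    K ⟶ (toMinusY hup hdown hφ A ⋙ MinusPoset.toPlusY hup hφ A).obj K :=
  natTransMk (G := (toMinusY hup hdown hφ A ⋙ MinusPoset.toPlusY hup hφ A).obj K)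
    (fun x => liftBiproductOn K x) (fun y => 𝟙 (K.obj (inr y)))
    (fun x x' h => map_liftBiproductOn hup K x x' h)
    (fun _ _ _ => (comp_id _).trans (id_comp _).symm)
    (fun x z y h => (comp_id _).trans
      (liftBiproductOn_fromBiproductOn hup K x y (inl_le_inr z h)).symm)

variable (hφ A) in
/-- The unit of the restriction to `Y`. -/
noncomputable def toPlusYUnit :
    𝟭 _ ⟶ toMinusY hup hdown hφ A ⋙ MinusPoset.toPlusY hup hφ A where
  app K := toPlusYUnitApp hup hdown K
  naturality K K' f := natTrans_ext (f := f ≫ toPlusYUnitApp hup hdown K')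
    (g := toPlusYUnitApp hup hdown K ≫
      (toMinusY hup hdown hφ A ⋙ MinusPoset.toPlusY hup hφ A).map f)
    (fun x => liftBiproductOn_naturality f x) (fun _ => (comp_id _).trans (id_comp _).symm)

end PlusPoset

namespace MinusPoset

/-- The component of `toPlusYToPlusX`. -/
noncomputable def toPlusYToPlusXApp (L : MinusPoset S hφ ⥤ A) :
    (toPlusY hup hφ A).obj L ⟶ (toPlusX S hφ A).obj L :=
  PlusPoset.natTransMk (F := (toPlusY hup hφ A).obj L) (G := (toPlusX S hφ A).obj L)
    (fun x => descBiproductOn L x) (fun _ => 0)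
    (fun x x' h => biproductOnMap_descBiproductOn hup hdown L x x' h)
    (fun _ _ _ => (isZero_zero A).eq_of_tgt _ _) (fun _ _ _ _ => (isZero_zero A).eq_of_tgt _ _)

variable (hφ A) in
/-- The natural transformation from `toPlusY` to `toPlusX`. -/
noncomputable def toPlusYToPlusX : toPlusY hup hφ A ⟶ toPlusX S hφ A where
  app L := toPlusYToPlusXApp hup hdown L
  naturality L L' f := PlusPoset.natTrans_ext
    (f := (toPlusY hup hφ A).map f ≫ toPlusYToPlusXApp hup hdown L')
    (g := toPlusYToPlusXApp hup hdown L ≫ (toPlusX S hφ A).map f)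
    (fun x => descBiproductOn_naturality f x) (fun _ => (isZero_zero A).eq_of_tgt _ _)

/-- The component of `toMinusXCounit`. -/
noncomputable def toMinusXCounitApp (L : MinusPoset S hφ ⥤ A) :
    (toPlusX S hφ A ⋙ PlusPoset.toMinusX S hφ A).obj L ⟶ L :=
  natTransMk (F := (toPlusX S hφ A ⋙ PlusPoset.toMinusX S hφ A).obj L)
    (fun x => 𝟙 (L.obj (inl x))) (fun _ => 0)
    (fun _ _ _ => (comp_id _).trans (id_comp _).symm)
    (fun _ _ _ => (isZero_zero A).eq_of_src _ _) (fun _ _ _ _ => (isZero_zero A).eq_of_src _ _)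

variable (S hφ A) in
/-- The counit of the restriction to `X`. -/
noncomputable def toMinusXCounit : toPlusX S hφ A ⋙ PlusPoset.toMinusX S hφ A ⟶ 𝟭 _ where
  app L := toMinusXCounitApp L
  naturality L L' f := natTrans_ext
    (f := (toPlusX S hφ A ⋙ PlusPoset.toMinusX S hφ A).map f ≫ toMinusXCounitApp L')
    (g := toMinusXCounitApp L ≫ f)
    (fun _ => (comp_id _).trans (id_comp _).symm) (fun _ => (isZero_zero A).eq_of_src _ _)

/-- The component of `toMinusYCounit`. -/
noncomputable def toMinusYCounitApp (L : MinusPoset S hφ ⥤ A) :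
    (toPlusY hup hφ A ⋙ PlusPoset.toMinusY hup hdown hφ A).obj L ⟶ L :=
  natTransMk (F := (toPlusY hup hφ A ⋙ PlusPoset.toMinusY hup hdown hφ A).obj L)
    (fun x => descBiproductOn L x) (fun y => 𝟙 (L.obj (inr y)))
    (fun x x' h => biproductOnMap_descBiproductOn hup hdown L x x' h)
    (fun _ _ _ => (comp_id _).trans (id_comp _).symm)
    (fun x z y h => (toBiproductOn_descBiproductOn hdown L x y (inr_le_inl z h)).trans
      (id_comp _).symm)

variable (hφ A) in
/-- The counit of the restriction to `Y`. -/
noncomputable def toMinusYCounit :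
    toPlusY hup hφ A ⋙ PlusPoset.toMinusY hup hdown hφ A ⟶ 𝟭 _ where
  app L := toMinusYCounitApp hup hdown L
  naturality L L' f := natTrans_ext
    (f := (toPlusY hup hφ A ⋙ PlusPoset.toMinusY hup hdown hφ A).map f ≫
      toMinusYCounitApp hup hdown L')
    (g := toMinusYCounitApp hup hdown L ≫ f)
    (fun x => descBiproductOn_naturality f x) (fun _ => (comp_id _).trans (id_comp _).symm)

end MinusPoset

end

/-! ### Pointwise exactness -/

open Limits Category Preadditive Pretriangulated CategoryTheory.Functor ZeroObject

section

variable {A : Type*} [Category A] [Abelian A]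

namespace CategoryTheory.ShortComplex

variable {J : Type*} [Category J]

/-- Evaluations preserve homology, and a diagram is zero when all its values are. -/
lemma exact_of_exact_evaluation (T : ShortComplex (J ⥤ A))
    (h : ∀ j : J, (T.map ((evaluation J A).obj j)).Exact) : T.Exact := by
  rw [exact_iff_isZero_homology, Functor.isZero_iff]
  exact fun j => ((exact_iff_isZero_homology _).1 (h j)).of_iso
    (T.mapHomologyIso ((evaluation J A).obj j)).symm

lemma shortExact_of_shortExact_evaluation (T : ShortComplex (J ⥤ A))
    (h : ∀ j : J, (T.map ((evaluation J A).obj j)).ShortExact) : T.ShortExact where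
  exact := T.exact_of_exact_evaluation fun j => (h j).exact
  mono_f := by
    have (j : J) : Mono (T.f.app j) := (h j).mono_f
    exact NatTrans.mono_of_mono_app _
  epi_g := by
    have (j : J) : Epi (T.g.app j) := (h j).epi_g
    exact NatTrans.epi_of_epi_app _

attribute [local instance] Abelian.hasFiniteBiproducts

/-- Exactness means that kernel inclusion followed by cokernel projection is zero. Splitting the
identity of `⨁ N` into its components reduces this to each `N i`. -/
lemma exact_biproduct_map {ι : Type*} [Finite ι] {M N P : ι → A} (f : ∀ i, M i ⟶ N i)
    (g : ∀ i, N i ⟶ P i) (zero : ∀ i, f i ≫ g i = 0)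
    (h : ∀ i, (ShortComplex.mk (f i) (g i) (zero i)).Exact)
    (zero' : biproduct.map f ≫ biproduct.map g = 0) :
    (ShortComplex.mk (biproduct.map f) (biproduct.map g) zero').Exact := by
  classical
  cases nonempty_fintype ι
  rw [exact_iff_kernel_ι_comp_cokernel_π_zero]
  change kernel.ι (biproduct.map g) ≫ cokernel.π (biproduct.map f) = 0
  have total : ∑ i, biproduct.π N i ≫ biproduct.ι N i = 𝟙 (⨁ N) :=
    biproduct.hom_ext' _ _ fun j => by
      rw [comp_sum, Finset.sum_eq_single j (fun i _ hi => by
        rw [biproduct.ι_π_ne_assoc _ hi.symm, zero_comp]) (by simp)]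
      simp
  rw [← id_comp (cokernel.π (biproduct.map f)), ← total, sum_comp, comp_sum]
  refine Finset.sum_eq_zero fun i _ => ?_
  refine Eq.trans ?_ ((h i).comp_eq_zero
    (a := kernel.ι (biproduct.map g) ≫ biproduct.π N i)
    (b := biproduct.ι N i ≫ cokernel.π (biproduct.map f)) ?_ ?_)
  · simp
  · rw [assoc, ← biproduct.map_π, kernel.condition_assoc, zero_comp]
  · exact (biproduct.ι_map_assoc f i (cokernel.π _)).symm.trans
      (by rw [cokernel.condition, comp_zero])

end CategoryTheory.ShortComplex

namespace CategoryTheory.Functor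

lemma preservesHomology_of_evaluation {B J : Type*} [Category B] [Abelian B] [Category J]
    (F : B ⥤ J ⥤ A) [F.PreservesZeroMorphisms]
    (hF : ∀ (T : ShortComplex B), T.Exact → ∀ j : J,
      ((T.map F).map ((evaluation J A).obj j)).Exact) : F.PreservesHomology :=
  F.preservesHomology_of_map_exact fun T hT =>
    ShortComplex.exact_of_exact_evaluation _ (hF T hT)

end CategoryTheory.Functor

end

/-! ### Exactness, vanishing and the two squares for the glued posets -/

section

variable {X : Type p} {Y : Type q} [PartialOrder X] [PartialOrder Y] {S : X → Set Y}
  (hup : ∀ x : X, ∀ y ∈ S x, ∀ y' ∈ S x, y ≠ y' → Set.Ici y ∩ Set.Ici y' = ∅)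
  (hdown : ∀ x : X, ∀ y ∈ S x, ∀ y' ∈ S x, y ≠ y' → Set.Iic y ∩ Set.Iic y' = ∅)
  {hφ : HasIncreasingBijections S} {A : Type*} [Category A] [Abelian A]

attribute [local instance] Abelian.hasFiniteBiproducts

omit [PartialOrder X] in
lemma biproductOn.map_add [∀ x, Finite (S x)] {N N' : Y ⥤ A} (f g : N ⟶ N') (x : X) :
    biproductOn.map S (f + g) x = biproductOn.map S f x + biproductOn.map S g x :=
  biproduct.hom_ext _ _ fun z => by simp [comp_add, add_comp]

namespace PlusPoset

instance additive_toMinusX : (toMinusX S hφ A).Additive where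
  map_add {_ _} f g := MinusPoset.natTrans_ext (f := (toMinusX S hφ A).map (f + g))
    (g := (toMinusX S hφ A).map f + (toMinusX S hφ A).map g)
    (fun _ => rfl) (fun _ => (isZero_zero A).eq_of_src _ _)

instance preservesHomology_toMinusX : (toMinusX S hφ A).PreservesHomology :=
  preservesHomology_of_evaluation _ fun T hT => by
    rintro (x | y)
    · exact hT.map ((evaluation _ A).obj (inl x))
    · exact ShortComplex.exact_of_isZero_X₂ _ (isZero_zero A)

variable [∀ x, Finite (S x)]

instance additive_toMinusY : (toMinusY hup hdown hφ A).Additive where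
  map_add {_ _} f g := MinusPoset.natTrans_ext (f := (toMinusY hup hdown hφ A).map (f + g))
    (g := (toMinusY hup hdown hφ A).map f + (toMinusY hup hdown hφ A).map g)
    (fun x => biproductOn.map_add (S := S) (whiskerLeft (inrFunctor S hφ) f)
      (whiskerLeft (inrFunctor S hφ) g) x) (fun _ => rfl)

instance preservesHomology_toMinusY : (toMinusY hup hdown hφ A).PreservesHomology :=
  preservesHomology_of_evaluation _ fun T hT => by
    rintro (x | y)
    · exact ShortComplex.exact_biproduct_map (ι := S x) _ _ _
        (fun z => hT.map ((evaluation _ A).obj (inr (z : Y)))) _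
    · exact hT.map ((evaluation _ A).obj (inr y))

end PlusPoset

namespace MinusPoset

instance additive_toPlusX : (toPlusX S hφ A).Additive where
  map_add {_ _} f g := PlusPoset.natTrans_ext (f := (toPlusX S hφ A).map (f + g))
    (g := (toPlusX S hφ A).map f + (toPlusX S hφ A).map g)
    (fun _ => rfl) (fun _ => (isZero_zero A).eq_of_src _ _)

instance preservesHomology_toPlusX : (toPlusX S hφ A).PreservesHomology :=
  preservesHomology_of_evaluation _ fun T hT => by
    rintro (x | y)
    · exact hT.map ((evaluation _ A).obj (inl x))
    · exact ShortComplex.exact_of_isZero_X₂ _ (isZero_zero A)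

variable [∀ x, Finite (S x)]

instance additive_toPlusY : (toPlusY hup hφ A).Additive where
  map_add {_ _} f g := PlusPoset.natTrans_ext (f := (toPlusY hup hφ A).map (f + g))
    (g := (toPlusY hup hφ A).map f + (toPlusY hup hφ A).map g)
    (fun x => biproductOn.map_add (S := S) (whiskerLeft (inrFunctor S hφ) f)
      (whiskerLeft (inrFunctor S hφ) g) x) (fun _ => rfl)

instance preservesHomology_toPlusY : (toPlusY hup hφ A).PreservesHomology :=
  preservesHomology_of_evaluation _ fun T hT => by
    rintro (x | y)
    · exact ShortComplex.exact_biproduct_map (ι := S x) _ _ _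
        (fun z => hT.map ((evaluation _ A).obj (inr (z : Y)))) _
    · exact hT.map ((evaluation _ A).obj (inr y))

end MinusPoset

variable [∀ x, Finite (S x)]

omit [PartialOrder X] in
lemma isZero_biproductOn (N : Y ⥤ A) (x : X) (hN : ∀ y, IsZero (N.obj y)) :
    IsZero (biproductOn (S := S) N x) :=
  (IsZero.iff_id_eq_zero _).2 (biproduct.hom_ext _ _ fun _ => (hN _).eq_of_tgt _ _)

/-- `toMinusY` only sees values on `Y`, where `toPlusX` is zero. -/
lemma isZero_toMinusY_toPlusX (L : MinusPoset S hφ ⥤ A) :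
    IsZero ((PlusPoset.toMinusY hup hdown hφ A).obj ((MinusPoset.toPlusX S hφ A).obj L)) := by
  rw [Functor.isZero_iff]
  rintro (x | y)
  · exact isZero_biproductOn (S := S)
      (PlusPoset.inrFunctor S hφ ⋙ (MinusPoset.toPlusX S hφ A).obj L) x fun _ => isZero_zero A
  · exact isZero_zero A

lemma isZero_toPlusY_toMinusX (K : PlusPoset S hφ ⥤ A) :
    IsZero ((MinusPoset.toPlusY hup hφ A).obj ((PlusPoset.toMinusX S hφ A).obj K)) := by
  rw [Functor.isZero_iff]
  rintro (x | y)
  · exact isZero_biproductOn (S := S)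
      (MinusPoset.inrFunctor S hφ ⋙ (PlusPoset.toMinusX S hφ A).obj K) x fun _ => isZero_zero A
  · exact isZero_zero A

/-- For a diagram extended from `Y` by biproducts, the structure map for `x ≤ z` with `z ∈ S x` is
the projection to `z`. -/
lemma liftBiproductOn_toPlusY (L : MinusPoset S hφ ⥤ A) (x : X) :
    PlusPoset.liftBiproductOn ((MinusPoset.toPlusY hup hφ A).obj L) x =
      𝟙 (biproductOn (S := S) (MinusPoset.inrFunctor S hφ ⋙ L) x) := by
  refine biproduct.hom_ext _ _ fun z => ?_
  refine (PlusPoset.liftBiproductOn_π ((MinusPoset.toPlusY hup hφ A).obj L) x z).trans ?_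
  refine (PlusPoset.fromBiproductOn_eq hup (hφ := hφ) (MinusPoset.inrFunctor S hφ ⋙ L) x z
    (PlusPoset.inl_le_inr z le_rfl) z le_rfl).trans ?_
  rw [map_homOfLE_self, comp_id]
  exact (id_comp (biproductOn.π S (MinusPoset.inrFunctor S hφ ⋙ L) x z)).symm

lemma descBiproductOn_toMinusY (K : PlusPoset S hφ ⥤ A) (x : X) :
    MinusPoset.descBiproductOn ((PlusPoset.toMinusY hup hdown hφ A).obj K) x =
      𝟙 (biproductOn (S := S) (PlusPoset.inrFunctor S hφ ⋙ K) x) := by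
  refine biproduct.hom_ext' _ _ fun z => ?_
  refine (MinusPoset.ι_descBiproductOn
    ((PlusPoset.toMinusY hup hdown hφ A).obj K) x z).trans ?_
  refine (MinusPoset.toBiproductOn_eq hdown (hφ := hφ) (PlusPoset.inrFunctor S hφ ⋙ K) x z
    (MinusPoset.inr_le_inl z le_rfl) z le_rfl).trans ?_
  rw [map_homOfLE_self, id_comp]
  exact (comp_id (biproductOn.ι S (PlusPoset.inrFunctor S hφ ⋙ K) x z)).symm

open PlusPoset MinusPoset

lemma commSq_toMinusX (L : MinusPoset S hφ ⥤ A) :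
    CommSq ((toMinusX S hφ A).map ((toPlusYToPlusX hup hdown hφ A).app L))
      ((toMinusXToMinusY hup hdown hφ A).app ((toPlusY hup hφ A).obj L))
      ((toMinusXCounit S hφ A).app L) ((toMinusYCounit hup hdown hφ A).app L) where
  w := MinusPoset.natTrans_ext
    (f := (toMinusX S hφ A).map ((toPlusYToPlusX hup hdown hφ A).app L) ≫
      (toMinusXCounit S hφ A).app L)
    (g := (toMinusXToMinusY hup hdown hφ A).app ((toPlusY hup hφ A).obj L) ≫
      (toMinusYCounit hup hdown hφ A).app L)
    (fun x => (comp_id (descBiproductOn L x)).trans ((id_comp _).symm.trans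
      (congr_arg (· ≫ descBiproductOn L x) (liftBiproductOn_toPlusY hup L x).symm)))
    (fun _ => (isZero_zero A).eq_of_src _ _)

lemma commSq_toPlusX (K : PlusPoset S hφ ⥤ A) :
    CommSq ((toPlusYUnit hup hdown hφ A).app K) ((toPlusXUnit S hφ A).app K)
      ((toPlusYToPlusX hup hdown hφ A).app ((toMinusY hup hdown hφ A).obj K))
      ((toPlusX S hφ A).map ((toMinusXToMinusY hup hdown hφ A).app K)) where
  w := PlusPoset.natTrans_ext
    (f := (toPlusYUnit hup hdown hφ A).app K ≫
      (toPlusYToPlusX hup hdown hφ A).app ((toMinusY hup hdown hφ A).obj K))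
    (g := (toPlusXUnit S hφ A).app K ≫
      (toPlusX S hφ A).map ((toMinusXToMinusY hup hdown hφ A).app K))
    (fun x => (congr_arg (liftBiproductOn K x ≫ ·) (descBiproductOn_toMinusY hup hdown K x)).trans
      ((comp_id (liftBiproductOn K x)).trans (id_comp _).symm))
    (fun _ => (isZero_zero A).eq_of_tgt _ _)

/-- The sequence splits at each point, but the pair of invertible sides may change with the point,
so it need not split globally. -/
lemma CategoryTheory.CommSq.shortExact_of_evaluation {J : Type*} [Category J]
    {F₁ F₂ F₃ F₄ : J ⥤ A} {f : F₁ ⟶ F₂} {g : F₁ ⟶ F₃} {inl : F₂ ⟶ F₄} {inr : F₃ ⟶ F₄}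
    (sq : CommSq f g inl inr)
    (h : ∀ j : J, (IsIso (f.app j) ∧ IsIso (inr.app j)) ∨ (IsIso (g.app j) ∧ IsIso (inl.app j))) :
    sq.shortComplex.ShortExact :=
  ShortComplex.shortExact_of_shortExact_evaluation _ fun j => by
    rw [ShortComplex.shortExact_iff_of_iso (sq.mapShortComplexIso ((evaluation J A).obj j))]
    obtain ⟨h₁, h₂⟩ | ⟨h₁, h₂⟩ := h j
    · have : IsIso (((evaluation J A).obj j).map f) := h₁
      have : IsIso (((evaluation J A).obj j).map inr) := h₂
      exact CommSq.shortExact_shortComplex_of_isIso _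
    · have : IsIso (((evaluation J A).obj j).map g) := h₁
      have : IsIso (((evaluation J A).obj j).map inl) := h₂
      exact CommSq.shortExact_shortComplex_of_isIso' _

lemma shortExact_commSq_toMinusX (L : MinusPoset S hφ ⥤ A) :
    (commSq_toMinusX hup hdown L).shortComplex.ShortExact :=
  CommSq.shortExact_of_evaluation _ <| by
    rintro (x | y)
    -- At `x` the square has corners `⨁ L z`, `L x`, `⨁ L z`, `L x`, with identities between equal
    -- corners; at `y` it is `0`, `0`, `L y`, `L y`.
    · refine Or.inr ⟨?_, IsIso.id (L.obj (MinusPoset.inl x))⟩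
      have : IsIso (liftBiproductOn ((toPlusY hup hφ A).obj L) x) := by
        rw [liftBiproductOn_toPlusY]
        exact IsIso.id _
      exact this
    · exact Or.inl ⟨isIso_of_source_target_iso_zero _ (Iso.refl _) (Iso.refl _),
        IsIso.id (L.obj (MinusPoset.inr y))⟩

lemma shortExact_commSq_toPlusX (K : PlusPoset S hφ ⥤ A) :
    (commSq_toPlusX hup hdown K).shortComplex.ShortExact :=
  CommSq.shortExact_of_evaluation _ <| by
    rintro (x | y)
    -- At `x` the corners are `K x`, `⨁ K z`, `K x`, `⨁ K z`; at `y` they are `K y`, `K y`, `0`,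
    -- `0`.
    · refine Or.inr ⟨IsIso.id (K.obj (PlusPoset.inl x)), ?_⟩
      have : IsIso (descBiproductOn ((toMinusY hup hdown hφ A).obj K) x) := by
        rw [descBiproductOn_toMinusY]
        exact IsIso.id _
      exact this
    · exact Or.inl ⟨IsIso.id (K.obj (PlusPoset.inr y)),
        isIso_of_source_target_iso_zero _ (Iso.refl _) (Iso.refl _)⟩

end

theorem theorem1p1 {X : Type p} {Y : Type q} [PartialOrder X] [Finite X]
    [PartialOrder Y] [Finite Y] (S : X → Set Y)
    (hup : ∀ x : X, ∀ y ∈ S x, ∀ y' ∈ S x, y ≠ y' → Set.Ici y ∩ Set.Ici y' = ∅)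
    (hdown : ∀ x : X, ∀ y ∈ S x, ∀ y' ∈ S x, y ≠ y' → Set.Iic y ∩ Set.Iic y' = ∅)
    (hφ : HasIncreasingBijections S) :
    UniversallyDerivedEquivalent.{u, v, w, w'} (PlusPoset S hφ) (MinusPoset S hφ) := by
  intro A _ _ _ _
  exact triangulatedEquivalent_of_coneFunctor
    (PlusPoset.toMinusXToMinusY hup hdown hφ A) (MinusPoset.toPlusYToPlusX hup hdown hφ A)
    (MinusPoset.toMinusXCounit S hφ A) (MinusPoset.toMinusYCounit hup hdown hφ A)
    (PlusPoset.toPlusYUnit hup hdown hφ A) (PlusPoset.toPlusXUnit S hφ A)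
    (isZero_toMinusY_toPlusX hup hdown) (isZero_toPlusY_toMinusX hup)
    (fun L => (commSq_toMinusX hup hdown L).w) (shortExact_commSq_toMinusX hup hdown)
    (fun K => (commSq_toPlusX hup hdown K).w) (shortExact_commSq_toPlusX hup hdown)
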